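/- Let $p,q\in\mathbb{R}$ and let $(M,J,g)$ be a metallic Riemannian manifold: $M$ is a smooth (finite-dimensional, Hausdorff, boundaryless) manifold, $g$ is a smooth Riemannian metric on $M$, and $J:TM\to TM$ is a smooth endomorphism with $J^2=pJ+qI$ and $g(JX,Y)=g(X,JY)$ for all $X,Y$. Let $\nabla$ be the Levi-Civita connection of $g$. Let $\pi:T^*M\to M$ be the projection. For $a\in T^*M$ let $\chi_a:T^*_{\pi(a)}M\to T_a(T^*M)$ be the natural identification of $T^*_{\pi(a)}M$ with the tangent space of the fibre at $a$, and for $X\in T_{\pi(a)}M$ let $X^H_a=(d\alpha)_{\pi(a)}(X)-\chi_a(\nabla_X\alpha)$ be the horizontal lift of $X$ at $a$, where $\alpha$ is any local $1$-form with $\alpha_{\pi(a)}=a$, regarded as a map to $T^*M$, and $(\nabla_X\alpha)(Y)=X(\alpha(Y))-\alpha(\nabla_XY)$. Let $$\Phi_a:T_{\pi(a)}M\oplus T^*_{\pi(a)}M\to T_a(T^*M),\qquad \Phi_a(X+\beta)=X^H_a+\chi_a(\beta),$$ which is an isomorphism. On $TM\oplus T^*M$ put $\hat J_m(X+\beta)=JX+\beta\circ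 J$ and $\hat g(X+\beta,Y+\gamma)=g(X,Y)+g(\sharp_g\beta,\sharp_g\gamma)$, where $\sharp_g:T^*M\to TM$ is the inverse of $X\mapsto g(X,\cdot)$. Define, on $T^*M$, $$\tilde J_m=\Phi\circ\hat J_m\circ\Phi^{-1},\qquad \tilde g=(\Phi^{-1})^*\hat g.$$ **Proposition.** If $(M,J,g)$ is locally metallic, i.e. $\nabla J=0$, and flat, i.e. the curvature of $\nabla$ vanishes, then $(\tilde J_m,\tilde g)$ is an integrable metallic Riemannian structure on $T^*M$. That is, $\tilde g$ is a smooth Riemannian metric on $T^*M$, $\tilde J_m$ is a smooth endomorphism of $T(T^*M)$ with $\tilde J_m^2=p\tilde J_m+qI$ and $\tilde g(\tilde J_mA,B)=\tilde g(A,\tilde J_mB)$ for all $A,B$, and its Nijenhuis tensor $$N_{\tilde J_m}(A,B)=[\tilde J_mA,\tilde J_mB]-\tilde J_m[\tilde J_mA,B]-\tilde J_m[A,\tilde J_mB]+\tilde J_m^2[A,B]$$ vanishes for all smooth vector fields $A,B$ on $T^*M$. -/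

import Mathlib

open Bundle Manifold VectorField
open scoped ContDiff

noncomputable section

namespace Metallic

variable {E : Type*} [NormedAddCommGroup E] [NormedSpace ℝ E]
  {H : Type*} [TopologicalSpace H] {I : ModelWithCorners ℝ E H}
  {M : Type*} [TopologicalSpace M] [ChartedSpace H M]

/-- A smooth vector field on `M`. -/
def IsSmoothField [IsManifold I ∞ M] (X : ∀ x : M, TangentSpace I x) : Prop :=
  ContMDiff I (I.prod 𝓘(ℝ, E)) ∞ (fun x => TotalSpace.mk' E x (X x))

/-- Smooth Riemannian metrics on the tangent bundle of `M`. -/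
abbrev TangentMetric (I : ModelWithCorners ℝ E H) (M : Type*) [TopologicalSpace M]
    [ChartedSpace H M] [IsManifold I ∞ M] :=
  ContMDiffRiemannianMetric I ∞ E (TangentSpace I : M → Type _)

/-- Linear connections on `M`, in the order of arguments `cov Y x v = (∇_v Y)(x)`. -/
abbrev TangentConnection (I : ModelWithCorners ℝ E H) (M : Type*) [TopologicalSpace M]
    [ChartedSpace H M] [IsManifold I ∞ M] :=
  CovariantDerivative I E (TangentSpace I : M → Type _)

/-! ### Metallic structures -/

/-- A metallic structure: a smooth endomorphism `J` of the tangent bundle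
with `J² = p J + q I`. -/
structure IsMetallicStructure [IsManifold I ∞ M] (p q : ℝ)
    (J : ∀ x : M, TangentSpace I x →L[ℝ] TangentSpace I x) : Prop where
  smooth : ContMDiff I (I.prod 𝓘(ℝ, E →L[ℝ] E)) ∞ (fun x => TotalSpace.mk' (E →L[ℝ] E) x (J x))
  sq_eq : ∀ (x : M) (v : TangentSpace I x), J x (J x v) = p • J x v + q • v

/-- A metallic Riemannian structure `(J, g)`: `J` is metallic and `g(JX, Y) = g(X, JY)`. -/
structure IsMetallicRiemannianStructure [IsManifold I ∞ M] (p q : ℝ)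
    (J : ∀ x : M, TangentSpace I x →L[ℝ] TangentSpace I x) (g : TangentMetric I M) : Prop where
  metallic : IsMetallicStructure p q J
  compatible : ∀ (x : M) (v w : TangentSpace I x), g.inner x (J x v) w = g.inner x v (J x w)

/-- The vector field `J X`. -/
def applyField (J : ∀ x : M, TangentSpace I x →L[ℝ] TangentSpace I x)
    (X : ∀ x : M, TangentSpace I x) : ∀ x : M, TangentSpace I x :=
  fun x => J x (X x)

/-- `N_J(X, Y) = [JX, JY] - J[JX, Y] - J[X, JY] + J²[X, Y]`. -/
def nijenhuis (J : ∀ x : M, TangentSpace I x →L[ℝ] TangentSpace I x)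
    (X Y : ∀ x : M, TangentSpace I x) (x : M) : TangentSpace I x :=
  mlieBracket I (applyField J X) (applyField J Y) x
    - J x (mlieBracket I (applyField J X) Y x)
    - J x (mlieBracket I X (applyField J Y) x)
    + J x (J x (mlieBracket I X Y x))

/-- Integrability: the Nijenhuis tensor vanishes on all smooth vector fields. -/
def IsIntegrable [IsManifold I ∞ M]
    (J : ∀ x : M, TangentSpace I x →L[ℝ] TangentSpace I x) : Prop :=
  ∀ X Y : (∀ x : M, TangentSpace I x), IsSmoothField X → IsSmoothField Y →
    ∀ x, nijenhuis J X Y x = 0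

/-! ### The Levi-Civita connection, parallel endomorphisms, curvature -/

/-- `cov` is the Levi-Civita connection of `g`: smooth, `∇g = 0`, torsion free. -/
structure IsLeviCivita [FiniteDimensional ℝ E] [IsManifold I ∞ M]
    (g : TangentMetric I M) (cov : TangentConnection I M) : Prop where
  smooth : CovariantDerivative.ContMDiffCovariantDerivative cov ∞
  metric : ∀ Y Z : (∀ x : M, TangentSpace I x), IsSmoothField Y → IsSmoothField Z →
    ∀ (x : M) (v : TangentSpace I x),
      mvfderiv I (fun y => g.inner y (Y y) (Z y)) x v
        = g.inner x (cov Y x v) (Z x) + g.inner x (Y x) (cov Z x v)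
  torsion_free : cov.torsion = 0

/-- `∇J = 0`, that is `∇_v (J Y) = J (∇_v Y)`. -/
def IsParallel [IsManifold I ∞ M] (cov : TangentConnection I M)
    (J : ∀ x : M, TangentSpace I x →L[ℝ] TangentSpace I x) : Prop :=
  ∀ Y : (∀ x : M, TangentSpace I x), IsSmoothField Y →
    ∀ (x : M) (v : TangentSpace I x), cov (applyField J Y) x v = J x (cov Y x v)

/-- `R(X, Y) Z = ∇_X ∇_Y Z - ∇_Y ∇_X Z - ∇_[X, Y] Z`. -/
def curvature [IsManifold I ∞ M] (cov : TangentConnection I M)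
    (X Y Z : ∀ x : M, TangentSpace I x) (x : M) : TangentSpace I x :=
  cov (fun y => cov Z y (Y y)) x (X x) - cov (fun y => cov Z y (X y)) x (Y x)
    - cov Z x (mlieBracket I X Y x)

/-- The curvature vanishes identically. -/
def IsFlat [IsManifold I ∞ M] (cov : TangentConnection I M) : Prop :=
  ∀ X Y Z : (∀ x : M, TangentSpace I x), IsSmoothField X → IsSmoothField Y → IsSmoothField Z →
    ∀ x, curvature cov X Y Z x = 0

/-! ### The cotangent bundle, its vertical and horizontal vectors -/

/-- The cotangent space at `x`. -/
abbrev Cotangent (I : ModelWithCorners ℝ E H) {M : Type*} [TopologicalSpace M]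
    [ChartedSpace H M] (x : M) : Type _ :=
  TangentSpace I x →L[ℝ] ℝ

/-- The total space `T*M`. -/
abbrev CotangentBundle (I : ModelWithCorners ℝ E H) (M : Type*) [TopologicalSpace M]
    [ChartedSpace H M] [IsManifold I ∞ M] : Type _ :=
  TotalSpace (E →L[ℝ] ℝ) (fun x : M => TangentSpace I x →L[ℝ] ℝ)

/-- The model with corners of `T*M`. -/
abbrev cotangentModel (I : ModelWithCorners ℝ E H) :
    ModelWithCorners ℝ (E × (E →L[ℝ] ℝ)) (ModelProd H (E →L[ℝ] ℝ)) :=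
  I.prod 𝓘(ℝ, E →L[ℝ] ℝ)

/-- The tangent map of the projection `T*M → M`. -/
def projTangent [IsManifold I ∞ M] (a : CotangentBundle I M) :
    TangentSpace (cotangentModel I) a →L[ℝ] TangentSpace I a.proj :=
  mfderiv (cotangentModel I) I (fun b : CotangentBundle I M => b.proj) a

/-- The identification `χ_a` of the cotangent space at `x = π(a)` with the vertical vectors
at `a`: the differential at `a` of the inclusion of the fibre. (As a topological vector space,
the fibre is definitionally `E →L[ℝ] ℝ`.) -/
def verticalLift [IsManifold I ∞ M] (a : CotangentBundle I M) :
    Cotangent I a.proj →L[ℝ] TangentSpace (cotangentModel I) a :=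
  mfderiv 𝓘(ℝ, E →L[ℝ] ℝ) (cotangentModel I)
    (fun β : E →L[ℝ] ℝ => (TotalSpace.mk' (E →L[ℝ] ℝ) a.proj β : CotangentBundle I M)) a.2

/-- A `1`-form on `M`, not necessarily smooth. -/
abbrev OneForm (I : ModelWithCorners ℝ E H) (M : Type*) [TopologicalSpace M]
    [ChartedSpace H M] : Type _ :=
  ∀ x : M, Cotangent I x

/-- A `1`-form as a map `M → T*M`. -/
def OneForm.toMap [IsManifold I ∞ M] (α : OneForm I M) : M → CotangentBundle I M :=
  fun x => TotalSpace.mk' (E →L[ℝ] ℝ) x (α x)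

/-- `(∇_v α)(Y) = v(α(Y)) - α(∇_v Y)` at `x`, as a linear form in `v`. -/
def dualDerivAux [IsManifold I ∞ M] (cov : TangentConnection I M) (α : OneForm I M) (x : M)
    (Y : ∀ x : M, TangentSpace I x) : TangentSpace I x →L[ℝ] ℝ :=
  mvfderiv I (fun y => α y (Y y)) x - (α x).comp (cov Y x)

theorem mdifferentiableAt_pairing [IsManifold I ∞ M] {α : OneForm I M} {x : M}
    (hα : MDifferentiableAt I (cotangentModel I) α.toMap x)
    {Y : ∀ x : M, TangentSpace I x} (hY : MDiffAt (T% Y) x) :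
    MDiffAt (fun y => α y (Y y)) x := by
  have : MDifferentiableAt I (I.prod 𝓘(ℝ))
      (fun m ↦ TotalSpace.mk' ℝ (E := Bundle.Trivial M ℝ) m (α m (Y m))) x := by
    apply MDifferentiableAt.clm_bundle_apply (F₁ := E)
    · exact hα
    · exact hY
  simp only [mdifferentiableAt_totalSpace] at this
  exact this.2

theorem tensorialAt_dualDerivAux [IsManifold I ∞ M]
    (cov : TangentConnection I M) {α : OneForm I M} {x : M}
    (hα : MDifferentiableAt I (cotangentModel I) α.toMap x) (v : TangentSpace I x) :
    TensorialAt I E (fun Y => dualDerivAux cov α x Y v) x where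
  smul {f Y} hf hY := by
    have h := mvfderiv_fun_mul hf (mdifferentiableAt_pairing hα hY)
    simp [dualDerivAux, cov.isCovariantDerivativeOn.leibniz hY hf, h]
    ring
  add {Y Z} hY hZ := by
    have h := mvfderiv_fun_add (mdifferentiableAt_pairing hα hY) (mdifferentiableAt_pairing hα hZ)
    simp [dualDerivAux, cov.isCovariantDerivativeOn.add hY hZ, h]
    ring

/-- The covector `∇_v α` at `x`, for a `1`-form `α` which is differentiable at `x`. -/
def dualDeriv [FiniteDimensional ℝ E] [IsManifold I ∞ M]
    (cov : TangentConnection I M) (α : OneForm I M) (x : M)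
    (hα : MDifferentiableAt I (cotangentModel I) α.toMap x) (v : TangentSpace I x) :
    Cotangent I x :=
  TensorialAt.mkHom (fun Y => dualDerivAux cov α x Y v) x (tensorialAt_dualDerivAux cov hα v)

/-- A `1`-form, smooth near `π(a)`, whose value at `π(a)` is `a`. -/
def extendCovector [IsManifold I ∞ M] (a : CotangentBundle I M) : OneForm I M :=
  FiberBundle.extend (E →L[ℝ] ℝ) a.2

theorem mdifferentiableAt_extendCovector [IsManifold I ∞ M] (a : CotangentBundle I M) :
    MDifferentiableAt I (cotangentModel I) (extendCovector a).toMap a.proj :=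
  (FiberBundle.contMDiffAt_extend (k := 1) (V := fun x : M => TangentSpace I x →L[ℝ] ℝ)
    I (E →L[ℝ] ℝ) a.2).mdifferentiableAt one_ne_zero

/-- The horizontal lift at `a` of `v ∈ T_π(a) M`: `v^H = dα(v) - χ_a(∇_v α)`, where `α` is a
`1`-form with `α(π(a)) = a`. -/
def horizontalLift [FiniteDimensional ℝ E] [IsManifold I ∞ M] (cov : TangentConnection I M)
    (a : CotangentBundle I M) : TangentSpace I a.proj →ₗ[ℝ] TangentSpace (cotangentModel I) a where
  toFun v :=
    (show TangentSpace (cotangentModel I) a from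
        mfderiv I (cotangentModel I) (extendCovector a).toMap a.proj v)
      - verticalLift a (dualDeriv cov (extendCovector a) a.proj
          (mdifferentiableAt_extendCovector a) v)
  map_add' v w := by
    have h : dualDeriv cov (extendCovector a) a.proj (mdifferentiableAt_extendCovector a) (v + w)
        = dualDeriv cov (extendCovector a) a.proj (mdifferentiableAt_extendCovector a) v
          + dualDeriv cov (extendCovector a) a.proj (mdifferentiableAt_extendCovector a) w := by
      ext u
      simp [dualDeriv, TensorialAt.mkHom_apply_eq_extend]
    rw [h, ContinuousLinearMap.map_add, ContinuousLinearMap.map_add]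
    exact add_sub_add_comm _ _ _ _
  map_smul' c v := by
    have h : dualDeriv cov (extendCovector a) a.proj (mdifferentiableAt_extendCovector a) (c • v)
        = c • dualDeriv cov (extendCovector a) a.proj (mdifferentiableAt_extendCovector a) v := by
      ext u
      simp [dualDeriv, TensorialAt.mkHom_apply_eq_extend]
    rw [h, ContinuousLinearMap.map_smul, ContinuousLinearMap.map_smul]
    exact (smul_sub c _ _).symm

/-- `Φ(v + β) = v^H + χ_a(β)`. -/
def Phi [FiniteDimensional ℝ E] [IsManifold I ∞ M] (cov : TangentConnection I M)
    (a : CotangentBundle I M) :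
    (TangentSpace I a.proj × Cotangent I a.proj) →ₗ[ℝ] TangentSpace (cotangentModel I) a :=
  (horizontalLift cov a).coprod (verticalLift a).toLinearMap

/-- The coordinate in the fibre, for the local trivialization of `T*M` at `π(a)`. -/
def fibreCoord [IsManifold I ∞ M] (x : M) (b : CotangentBundle I M) : E →L[ℝ] ℝ :=
  (trivializationAt (E →L[ℝ] ℝ) (fun x : M => TangentSpace I x →L[ℝ] ℝ) x b).2

theorem mdifferentiableAt_fibreInclusion [IsManifold I ∞ M] (a : CotangentBundle I M) :
    MDifferentiableAt 𝓘(ℝ, E →L[ℝ] ℝ) (cotangentModel I)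
      (fun β : E →L[ℝ] ℝ => (TotalSpace.mk' (E →L[ℝ] ℝ) a.proj β : CotangentBundle I M)) a.2 := by
  refine (mdifferentiableAt_totalSpace I _).2 ⟨mdifferentiableAt_const, ?_⟩
  let L := (trivializationAt (E →L[ℝ] ℝ) (fun x : M => TangentSpace I x →L[ℝ] ℝ)
    a.proj).continuousLinearMapAt ℝ a.proj
  have hL : MDifferentiableAt 𝓘(ℝ, E →L[ℝ] ℝ) 𝓘(ℝ, E →L[ℝ] ℝ)
      (fun β : E →L[ℝ] ℝ => (L β : E →L[ℝ] ℝ)) a.2 :=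
    (ContinuousLinearMap.differentiableAt (E := E →L[ℝ] ℝ) L).mdifferentiableAt
  refine hL.congr_of_eventuallyEq (Filter.Eventually.of_forall fun β => ?_)
  exact (congrFun (Trivialization.coe_linearMapAt_of_mem (R := ℝ)
    (trivializationAt (E →L[ℝ] ℝ) (fun x : M => TangentSpace I x →L[ℝ] ℝ) a.proj)
    (FiberBundle.mem_baseSet_trivializationAt' a.proj)) β).symm

theorem projTangent_verticalLift [IsManifold I ∞ M] (a : CotangentBundle I M)
    (β : Cotangent I a.proj) : projTangent a (verticalLift a β) = 0 := by
  have hp : MDifferentiableAt (cotangentModel I) I (fun b : CotangentBundle I M => b.proj) a :=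
    mdifferentiableAt_proj (fun x : M => TangentSpace I x →L[ℝ] ℝ)
  have h := mfderiv_comp (M := E →L[ℝ] ℝ) (I := 𝓘(ℝ, E →L[ℝ] ℝ)) (I' := cotangentModel I)
    (I'' := I) a.2 (g := fun b : CotangentBundle I M => b.proj) hp
    (mdifferentiableAt_fibreInclusion a)
  have h0 : mfderiv 𝓘(ℝ, E →L[ℝ] ℝ) I ((fun b : CotangentBundle I M => b.proj) ∘
      (fun β : E →L[ℝ] ℝ => (TotalSpace.mk' (E →L[ℝ] ℝ) a.proj β : CotangentBundle I M))) a.2 = 0 :=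
    mfderiv_const
  rw [h0] at h
  exact (congrArg (fun T : (E →L[ℝ] ℝ) →L[ℝ] E => T β) h).symm

theorem verticalLift_injective [IsManifold I ∞ M] (a : CotangentBundle I M) :
    Function.Injective (verticalLift a) := by
  let e := trivializationAt (E →L[ℝ] ℝ) (fun x : M => TangentSpace I x →L[ℝ] ℝ) a.proj
  let L : (E →L[ℝ] ℝ) →L[ℝ] (E →L[ℝ] ℝ) := e.continuousLinearMapAt ℝ a.proj
  have hx : a.proj ∈ e.baseSet := FiberBundle.mem_baseSet_trivializationAt' a.proj
  have hf : MDifferentiableAt (cotangentModel I) 𝓘(ℝ, E →L[ℝ] ℝ)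
      (fibreCoord (I := I) a.proj) a :=
    ((mdifferentiableAt_totalSpace (F := E →L[ℝ] ℝ) (IM := cotangentModel I) (x₀ := a)
      (E := fun x : M => TangentSpace I x →L[ℝ] ℝ) I
      (fun b : CotangentBundle I M => b)).1 mdifferentiableAt_id).2
  have h := mfderiv_comp (M := E →L[ℝ] ℝ) (I := 𝓘(ℝ, E →L[ℝ] ℝ)) (I' := cotangentModel I)
    (I'' := 𝓘(ℝ, E →L[ℝ] ℝ)) a.2 (g := fibreCoord (I := I) a.proj) hf
    (mdifferentiableAt_fibreInclusion a)
  have hc : (fibreCoord (I := I) a.proj ∘ (fun β : E →L[ℝ] ℝ =>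
      (TotalSpace.mk' (E →L[ℝ] ℝ) a.proj β : CotangentBundle I M))) = L := by
    funext β
    exact (congrFun (Trivialization.coe_linearMapAt_of_mem (R := ℝ) e hx) β).symm
  have hL : mfderiv 𝓘(ℝ, E →L[ℝ] ℝ) 𝓘(ℝ, E →L[ℝ] ℝ) (fibreCoord (I := I) a.proj ∘
      (fun β : E →L[ℝ] ℝ => (TotalSpace.mk' (E →L[ℝ] ℝ) a.proj β : CotangentBundle I M)))
      (a.2 : E →L[ℝ] ℝ) = L := by
    rw [hc]
    exact mfderiv_eq_fderiv.trans (ContinuousLinearMap.fderiv L)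
  have h' := hL.symm.trans h
  intro β γ hβγ
  have h1 : L β = L γ := by
    rw [h']
    exact congrArg (mfderiv (cotangentModel I) 𝓘(ℝ, E →L[ℝ] ℝ) (fibreCoord (I := I) a.proj) a) hβγ
  have hb (δ : E →L[ℝ] ℝ) : (e.continuousLinearEquivAt ℝ a.proj hx) δ = L δ :=
    (congrFun (Trivialization.coe_linearMapAt_of_mem (R := ℝ) e hx) δ).symm
  exact (e.continuousLinearEquivAt ℝ a.proj hx).injective ((hb β).trans (h1.trans (hb γ).symm))

theorem projTangent_horizontalLift [FiniteDimensional ℝ E] [IsManifold I ∞ M]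
    (cov : TangentConnection I M) (a : CotangentBundle I M) (v : TangentSpace I a.proj) :
    projTangent a (horizontalLift cov a v) = v := by
  have hp : MDifferentiableAt (cotangentModel I) I (fun b : CotangentBundle I M => b.proj)
      ((extendCovector a).toMap a.proj) :=
    mdifferentiableAt_proj (fun x : M => TangentSpace I x →L[ℝ] ℝ)
  have h := mfderiv_comp (I := I) (I' := cotangentModel I) (I'' := I) a.proj
    (g := fun b : CotangentBundle I M => b.proj) hp (mdifferentiableAt_extendCovector a)
  have h0 : mfderiv I I ((fun b : CotangentBundle I M => b.proj) ∘ (extendCovector a).toMap) a.proj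
      = ContinuousLinearMap.id ℝ _ := mfderiv_id
  rw [h0] at h
  have h1 := (congrArg (fun T : E →L[ℝ] E => T v) h).symm
  have ha : (extendCovector a).toMap a.proj = a := by
    simp [OneForm.toMap, extendCovector]
  have h2 : projTangent a (show TangentSpace (cotangentModel I) a from
      mfderiv I (cotangentModel I) (extendCovector a).toMap a.proj v) = v := by
    refine Eq.trans ?_ h1
    change (mfderiv (cotangentModel I) I (fun b : CotangentBundle I M => b.proj) a :
      (E × (E →L[ℝ] ℝ)) →L[ℝ] E) _ = (mfderiv (cotangentModel I) I
        (fun b : CotangentBundle I M => b.proj) ((extendCovector a).toMap a.proj) :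
      (E × (E →L[ℝ] ℝ)) →L[ℝ] E) _
    rw [ha]
    rfl
  change projTangent a ((show TangentSpace (cotangentModel I) a from
      mfderiv I (cotangentModel I) (extendCovector a).toMap a.proj v) - verticalLift a _) = v
  rw [ContinuousLinearMap.map_sub, h2, projTangent_verticalLift, sub_zero]

theorem Phi_bijective [FiniteDimensional ℝ E] [IsManifold I ∞ M] (cov : TangentConnection I M)
    (a : CotangentBundle I M) : Function.Bijective (Phi cov a) := by
  have hinj : Function.Injective (Phi cov a) := by
    rw [injective_iff_map_eq_zero]
    rintro ⟨v, β⟩ h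
    have h' : horizontalLift cov a v + verticalLift a β = 0 := h
    have h1 := congrArg (projTangent a) h'
    rw [ContinuousLinearMap.map_add, projTangent_horizontalLift, projTangent_verticalLift,
      add_zero, ContinuousLinearMap.map_zero] at h1
    subst h1
    rw [LinearMap.map_zero, zero_add] at h'
    have h2 : β = 0 := verticalLift_injective a (h'.trans (ContinuousLinearMap.map_zero _).symm)
    rw [h2]
    rfl
  have : FiniteDimensional ℝ (TangentSpace I a.proj × Cotangent I a.proj) :=
    inferInstanceAs (FiniteDimensional ℝ (E × (E →L[ℝ] ℝ)))
  have : FiniteDimensional ℝ (TangentSpace (cotangentModel I) a) :=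
    inferInstanceAs (FiniteDimensional ℝ (E × (E →L[ℝ] ℝ)))
  exact ⟨hinj, (LinearMap.injective_iff_surjective_of_finrank_eq_finrank rfl).1 hinj⟩

/-- `Φ` as a fibrewise isomorphism `T_π(a) M ⊕ T*_π(a) M ≃ T_a(T*M)`. -/
def PhiEquiv [FiniteDimensional ℝ E] [IsManifold I ∞ M] (cov : TangentConnection I M)
    (a : CotangentBundle I M) :
    (TangentSpace I a.proj × Cotangent I a.proj) ≃L[ℝ] TangentSpace (cotangentModel I) a :=
  have : FiniteDimensional ℝ (TangentSpace I a.proj × Cotangent I a.proj) :=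
    inferInstanceAs (FiniteDimensional ℝ (E × (E →L[ℝ] ℝ)))
  haveI : T2Space (TangentSpace I a.proj × Cotangent I a.proj) :=
    inferInstanceAs (T2Space (E × (E →L[ℝ] ℝ)))
  haveI : T2Space (TangentSpace (cotangentModel I) a) :=
    inferInstanceAs (T2Space (E × (E →L[ℝ] ℝ)))
  (LinearEquiv.ofBijective (Phi cov a) (Phi_bijective cov a)).toContinuousLinearEquiv

/-! ### The musical isomorphism and the generalized structure on `TM ⊕ T*M` -/

theorem flat_bijective [FiniteDimensional ℝ E] [IsManifold I ∞ M] (g : TangentMetric I M) (x : M) :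
    Function.Bijective (g.inner x) := by
  have hinj : Function.Injective (g.inner x).toLinearMap := by
    rw [injective_iff_map_eq_zero]
    intro v hv
    by_contra hne
    have h := g.pos x v hne
    have h0 : g.inner x v v = 0 := congrArg (fun φ : Cotangent I x => φ v) hv
    exact absurd h0 h.ne'
  have : FiniteDimensional ℝ (TangentSpace I x) := inferInstanceAs (FiniteDimensional ℝ E)
  have : FiniteDimensional ℝ (Cotangent I x) :=
    inferInstanceAs (FiniteDimensional ℝ (E →L[ℝ] ℝ))
  refine ⟨hinj, (LinearMap.injective_iff_surjective_of_finrank_eq_finrank ?_).1 hinj⟩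
  exact ((LinearMap.toContinuousLinearMap (𝕜 := ℝ) (E := E) (F' := ℝ)).finrank_eq.symm.trans
    (Subspace.dual_finrank_eq (K := ℝ) (V := E))).symm

/-- `♯_g`, the inverse of `♭_g : v ↦ g(v, ·)`. -/
def sharp [FiniteDimensional ℝ E] [IsManifold I ∞ M] (g : TangentMetric I M) (x : M) :
    Cotangent I x →ₗ[ℝ] TangentSpace I x :=
  (LinearEquiv.ofBijective (g.inner x).toLinearMap (flat_bijective g x)).symm.toLinearMap

/-- `Ĵ_m (v + β) = J v + J* β`, where `J* β = β ∘ J`. -/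
def generalizedJ (J : ∀ x : M, TangentSpace I x →L[ℝ] TangentSpace I x) (x : M) :
    (TangentSpace I x × Cotangent I x) →L[ℝ] (TangentSpace I x × Cotangent I x) :=
  (J x).prodMap (ContinuousLinearMap.precomp ℝ (J x))

/-- `ĝ(v + β, w + γ) = g(v, w) + g(♯ β, ♯ γ)`. -/
def generalizedMetric [FiniteDimensional ℝ E] [IsManifold I ∞ M] (g : TangentMetric I M) (x : M)
    (s t : TangentSpace I x × Cotangent I x) : ℝ :=
  g.inner x s.1 t.1 + g.inner x (sharp g x s.2) (sharp g x t.2)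

/-! ### The lifted structure on `T*M` -/

/-- `J̃_m = Φ ∘ Ĵ_m ∘ Φ⁻¹`. -/
def liftedJ [FiniteDimensional ℝ E] [IsManifold I ∞ M] (cov : TangentConnection I M)
    (J : ∀ x : M, TangentSpace I x →L[ℝ] TangentSpace I x) (a : CotangentBundle I M) :
    TangentSpace (cotangentModel I) a →L[ℝ] TangentSpace (cotangentModel I) a :=
  (PhiEquiv cov a).toContinuousLinearMap ∘L generalizedJ J a.proj ∘L
    (PhiEquiv cov a).symm.toContinuousLinearMap

/-- `g̃ = (Φ⁻¹)^* ĝ`. -/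
def liftedMetric [FiniteDimensional ℝ E] [IsManifold I ∞ M] (cov : TangentConnection I M)
    (g : TangentMetric I M) (a : CotangentBundle I M)
    (A B : TangentSpace (cotangentModel I) a) : ℝ :=
  generalizedMetric g a.proj ((PhiEquiv cov a).symm A) ((PhiEquiv cov a).symm B)

end Metallic

end

noncomputable section
namespace Metallic

section VectorSpace

variable {V : Type*} [NormedAddCommGroup V] [NormedSpace ℝ V]

/-- The Nijenhuis tensor of a field of endomorphisms of a normed space, as a bilinear expression
in the values of the two vector fields. -/
def nijenhuisAt (P : V → V →L[ℝ] V) (z : V) (a w : V) : V :=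
  fderiv ℝ P z (P z a) w - fderiv ℝ P z (P z w) a - P z (fderiv ℝ P z a w) + P z (fderiv ℝ P z w a)

theorem lieBracket_nijenhuis {P : V → V →L[ℝ] V} {X Y : V → V} {z : V}
    (hP : DifferentiableAt ℝ P z) (hX : DifferentiableAt ℝ X z) (hY : DifferentiableAt ℝ Y z) :
    lieBracket ℝ (fun y => P y (X y)) (fun y => P y (Y y)) z
      - P z (lieBracket ℝ (fun y => P y (X y)) Y z)
      - P z (lieBracket ℝ X (fun y => P y (Y y)) z)
      + P z (P z (lieBracket ℝ X Y z)) = nijenhuisAt P z (X z) (Y z) := by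
  simp only [lieBracket, nijenhuisAt, fderiv_clm_apply hP hX, fderiv_clm_apply hP hY]
  simp only [add_apply, ContinuousLinearMap.comp_apply,
    ContinuousLinearMap.flip_apply, map_sub, map_add]
  abel

/-- The lift to `V × V*` of a field of endomorphisms of `V`, in coordinates. -/
def cotangentLift (P : V → V →L[ℝ] V) (z : V × (V →L[ℝ] ℝ)) :
    (V × (V →L[ℝ] ℝ)) →L[ℝ] (V × (V →L[ℝ] ℝ)) :=
  ((P z.1).comp (ContinuousLinearMap.fst ℝ V (V →L[ℝ] ℝ))).prod
    ((ContinuousLinearMap.precomp ℝ (P z.1)).comp (ContinuousLinearMap.snd ℝ V (V →L[ℝ] ℝ))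
      + ((ContinuousLinearMap.postcomp V z.2).comp
          (fderiv ℝ P z.1 - (fderiv ℝ P z.1).flip)).comp (ContinuousLinearMap.fst ℝ V (V →L[ℝ] ℝ)))

@[simp] theorem cotangentLift_apply_fst (P : V → V →L[ℝ] V) (z A : V × (V →L[ℝ] ℝ)) :
    (cotangentLift P z A).1 = P z.1 A.1 := rfl

@[simp] theorem cotangentLift_apply_snd (P : V → V →L[ℝ] V) (z A : V × (V →L[ℝ] ℝ)) (w : V) :
    (cotangentLift P z A).2 w
      = A.2 (P z.1 w) + z.2 (fderiv ℝ P z.1 A.1 w - fderiv ℝ P z.1 w A.1) := rfl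

set_option synthInstance.maxHeartbeats 200000 in
theorem contDiffAt_cotangentLift {P : V → V →L[ℝ] V} {z : V × (V →L[ℝ] ℝ)}
    (hP : ContDiffAt ℝ ∞ P z.1) : ContDiffAt ℝ ∞ (cotangentLift P) z := by
  have h1 : ContDiffAt ℝ ∞ (fun z : V × (V →L[ℝ] ℝ) => P z.1) z := hP.comp z contDiffAt_fst
  have h2 : ContDiffAt ℝ ∞ (fun z : V × (V →L[ℝ] ℝ) => fderiv ℝ P z.1) z :=
    (hP.fderiv_right (m := ∞) (by simp)).comp z contDiffAt_fst
  have h3 : ContDiffAt ℝ ∞ (fun z : V × (V →L[ℝ] ℝ) => (fderiv ℝ P z.1).flip) z :=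
    (ContinuousLinearMap.flipₗᵢ ℝ V V V).contDiff.contDiffAt.comp z h2
  have c4 : ContDiff ℝ ∞ (fun T : V →L[ℝ] V =>
      (ContinuousLinearMap.precomp ℝ T : (V →L[ℝ] ℝ) →L[ℝ] (V →L[ℝ] ℝ))) :=
    show ContDiff ℝ ∞ ⇑(ContinuousLinearMap.compL ℝ V V ℝ).flip from
      ContinuousLinearMap.contDiff _
  have c5 : ContDiff ℝ ∞ (fun ξ : V →L[ℝ] ℝ =>
      (ContinuousLinearMap.postcomp V ξ : (V →L[ℝ] V) →L[ℝ] (V →L[ℝ] ℝ))) :=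
    show ContDiff ℝ ∞ ⇑(ContinuousLinearMap.compL ℝ V V ℝ) from
      ContinuousLinearMap.contDiff _
  have h4 := c4.contDiffAt.comp z h1
  have h5 := c5.contDiffAt.comp z (contDiffAt_snd (p := z))
  have h6 := (h4.clm_comp (contDiffAt_const (c := ContinuousLinearMap.snd ℝ V (V →L[ℝ] ℝ)))).add
    ((h5.clm_comp (h2.sub h3)).clm_comp
      (contDiffAt_const (c := ContinuousLinearMap.fst ℝ V (V →L[ℝ] ℝ))))
  have h7 := h1.clm_comp (contDiffAt_const (c := ContinuousLinearMap.fst ℝ V (V →L[ℝ] ℝ)))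
  have h8 := ((contDiffAt_const (c := ContinuousLinearMap.inl ℝ V (V →L[ℝ] ℝ))).clm_comp h7).add
    ((contDiffAt_const (c := ContinuousLinearMap.inr ℝ V (V →L[ℝ] ℝ))).clm_comp h6)
  refine h8.congr_of_eventuallyEq (Filter.Eventually.of_forall fun y => ?_)
  refine ContinuousLinearMap.ext fun A => Prod.ext ?_ ?_
  · exact (add_zero _).symm
  · exact (zero_add _).symm

theorem fderiv_cotangentLift_fst {P : V → V →L[ℝ] V} {z : V × (V →L[ℝ] ℝ)}
    (hP : ContDiffAt ℝ ∞ P z.1) (A B : V × (V →L[ℝ] ℝ)) :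
    (fderiv ℝ (cotangentLift P) z A B).1 = fderiv ℝ P z.1 A.1 B.1 := by
  have hd : DifferentiableAt ℝ (cotangentLift P) z :=
    (contDiffAt_cotangentLift hP).differentiableAt (by simp)
  have h1 : HasFDerivAt (fun y => (cotangentLift P y B).1)
      ((ContinuousLinearMap.fst ℝ V (V →L[ℝ] ℝ)).comp
        ((fderiv ℝ (cotangentLift P) z).flip B)) z := by
    have := hd.hasFDerivAt.clm_apply (hasFDerivAt_const B z)
    simpa using! (ContinuousLinearMap.fst ℝ V (V →L[ℝ] ℝ)).hasFDerivAt.comp z this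
  have hPd : HasFDerivAt P (fderiv ℝ P z.1) z.1 := (hP.differentiableAt (by simp)).hasFDerivAt
  have h2 : HasFDerivAt (fun y : V × (V →L[ℝ] ℝ) => P y.1 B.1)
      (((fderiv ℝ P z.1).flip B.1).comp (ContinuousLinearMap.fst ℝ V (V →L[ℝ] ℝ))) z := by
    simpa using! (hPd.clm_apply (hasFDerivAt_const B.1 z.1)).comp z hasFDerivAt_fst
  exact congrArg (fun T : (V × (V →L[ℝ] ℝ)) →L[ℝ] V => T A) (h1.unique h2)

set_option synthInstance.maxHeartbeats 200000 in
set_option maxHeartbeats 1000000 in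
theorem fderiv_cotangentLift_snd {P : V → V →L[ℝ] V} {z : V × (V →L[ℝ] ℝ)}
    (hP : ContDiffAt ℝ ∞ P z.1) (A B : V × (V →L[ℝ] ℝ)) (w : V) :
    (fderiv ℝ (cotangentLift P) z A B).2 w = B.2 (fderiv ℝ P z.1 A.1 w)
      + A.2 (fderiv ℝ P z.1 B.1 w - fderiv ℝ P z.1 w B.1)
      + z.2 (fderiv ℝ (fderiv ℝ P) z.1 A.1 B.1 w - fderiv ℝ (fderiv ℝ P) z.1 A.1 w B.1) := by
  have hd : DifferentiableAt ℝ (cotangentLift P) z :=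
    (contDiffAt_cotangentLift hP).differentiableAt (by simp)
  let ev : (V × (V →L[ℝ] ℝ)) →L[ℝ] ℝ :=
    (ContinuousLinearMap.apply ℝ ℝ w).comp (ContinuousLinearMap.snd ℝ V (V →L[ℝ] ℝ))
  have h1 : HasFDerivAt (fun y => (cotangentLift P y B).2 w)
      (ev.comp ((fderiv ℝ (cotangentLift P) z).flip B)) z := by
    have := hd.hasFDerivAt.clm_apply (hasFDerivAt_const B z)
    simpa only [ContinuousLinearMap.comp_zero, zero_add] using! ev.hasFDerivAt.comp z this
  have hPd : HasFDerivAt P (fderiv ℝ P z.1) z.1 := (hP.differentiableAt (by simp)).hasFDerivAt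
  have hQd : HasFDerivAt (fderiv ℝ P) (fderiv ℝ (fderiv ℝ P) z.1) z.1 :=
    ((hP.fderiv_right (m := ∞) (by simp)).differentiableAt (by simp)).hasFDerivAt
  have hf : HasFDerivAt (fun y : V × (V →L[ℝ] ℝ) => y.1) (ContinuousLinearMap.fst ℝ V (V →L[ℝ] ℝ)) z :=
    hasFDerivAt_fst
  have hP' := ((hPd.comp z hf).clm_apply (hasFDerivAt_const w z))
  have hQ (b c : V) : HasFDerivAt (fun y : V × (V →L[ℝ] ℝ) => fderiv ℝ P y.1 b c) _ z :=
    HasFDerivAt.clm_apply (c := fun y : V × (V →L[ℝ] ℝ) => fderiv ℝ P y.1 b)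
      ((hQd.comp z hf).clm_apply (hasFDerivAt_const b z)) (hasFDerivAt_const c z)
  have h2 := (B.2.hasFDerivAt.comp z hP').add
    ((hasFDerivAt_snd (𝕜 := ℝ) (p := z)).clm_apply ((hQ B.1 w).sub (hQ w B.1)))
  have := congrArg (fun T : (V × (V →L[ℝ] ℝ)) →L[ℝ] ℝ => T A) (h1.unique h2)
  refine this.trans ?_
  simp
  ring

set_option synthInstance.maxHeartbeats 200000 in
set_option maxHeartbeats 1000000 in
/-- If the Nijenhuis tensor of `P` vanishes near a point, then so does that of its lift to
the cotangent bundle at the points above. -/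
theorem nijenhuisAt_cotangentLift {P : V → V →L[ℝ] V} {z : V × (V →L[ℝ] ℝ)}
    (hP : ContDiffAt ℝ ∞ P z.1) (hN : ∀ᶠ y in nhds z.1, ∀ a w, nijenhuisAt P y a w = 0)
    (A B : V × (V →L[ℝ] ℝ)) : nijenhuisAt (cotangentLift P) z A B = 0 := by
  have hPd : HasFDerivAt P (fderiv ℝ P z.1) z.1 := (hP.differentiableAt (by simp)).hasFDerivAt
  have hQd : HasFDerivAt (fderiv ℝ P) (fderiv ℝ (fderiv ℝ P) z.1) z.1 :=
    ((hP.fderiv_right (m := ∞) (by simp)).differentiableAt (by simp)).hasFDerivAt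
  have hsymm (u v w : V) : fderiv ℝ (fderiv ℝ P) z.1 u v w = fderiv ℝ (fderiv ℝ P) z.1 v u w :=
    congrArg (fun T : V →L[ℝ] V => T w)
      ((hP.isSymmSndFDerivAt (by simpa using! (ENat.LEInfty.out : (2 : WithTop ℕ∞) ≤ ∞))).eq u v)
  have hN0 (a w : V) : nijenhuisAt P z.1 a w = 0 := hN.self_of_nhds a w
  have hD (u a w : V) :
      fderiv ℝ (fderiv ℝ P) z.1 u (P z.1 a) w + fderiv ℝ P z.1 (fderiv ℝ P z.1 u a) w
      - fderiv ℝ (fderiv ℝ P) z.1 u (P z.1 w) a - fderiv ℝ P z.1 (fderiv ℝ P z.1 u w) a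
      - fderiv ℝ P z.1 u (fderiv ℝ P z.1 a w) - P z.1 (fderiv ℝ (fderiv ℝ P) z.1 u a w)
      + fderiv ℝ P z.1 u (fderiv ℝ P z.1 w a) + P z.1 (fderiv ℝ (fderiv ℝ P) z.1 u w a) = 0 := by
    have hp (b : V) := hPd.clm_apply (hasFDerivAt_const b z.1)
    have hq (b c : V) := (hQd.clm_apply (hasFDerivAt_const b z.1)).clm_apply
      (hasFDerivAt_const c z.1)
    have h1 := ((((hQd.clm_apply (hp a)).clm_apply (hasFDerivAt_const w z.1)).sub
      ((hQd.clm_apply (hp w)).clm_apply (hasFDerivAt_const a z.1))).sub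
      (hPd.clm_apply (hq a w))).add (hPd.clm_apply (hq w a))
    have h0 : HasFDerivAt (fun y => nijenhuisAt P y a w) (0 : V →L[ℝ] V) z.1 :=
      (hasFDerivAt_const (0 : V) z.1).congr_of_eventuallyEq (hN.mono fun y hy => hy a w)
    have := congrArg (fun T : V →L[ℝ] V => T u) (h1.unique h0)
    simp at this
    rw [← this]
    abel
  simp only [nijenhuisAt] at hN0
  refine Prod.ext ?_ (ContinuousLinearMap.ext fun w => ?_)
  · simpa [nijenhuisAt, fderiv_cotangentLift_fst hP] using hN0 A.1 B.1
  · obtain ⟨a, α⟩ := A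
    obtain ⟨u, η⟩ := B
    have e1 := congrArg α (hN0 u w)
    have e2 := congrArg η (hN0 a w)
    have e3 := congrArg z.2 (hD u a w)
    have e4 := congrArg z.2 (hD a w u)
    have e5 := congrArg z.2 (hD w u a)
    simp only [nijenhuisAt, fderiv_cotangentLift_snd hP, fderiv_cotangentLift_fst hP,
      cotangentLift_apply_fst, cotangentLift_apply_snd, Prod.snd_add, Prod.snd_sub,
      add_apply, sub_apply, map_add, map_sub, map_zero,
      Prod.snd_zero, zero_apply] at e1 e2 e3 e4 e5 ⊢
    simp only [hsymm (P z.1 _)]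
    rw [hsymm a u, hsymm w a, hsymm w u] at *
    linarith

end VectorSpace

section Frame

variable {E : Type*} [NormedAddCommGroup E] [NormedSpace ℝ E]
  {H : Type*} [TopologicalSpace H] {I : ModelWithCorners ℝ E H}
  {M : Type*} [TopologicalSpace M] [ChartedSpace H M] [IsManifold I ∞ M]

/-- The coordinates of tangent vectors at `x` in the chart at `x₀`. -/
def coframe (x₀ x : M) : TangentSpace I x →L[ℝ] E :=
  (trivializationAt E (TangentSpace I) x₀).continuousLinearMapAt ℝ x

/-- The tangent vector at `x` with given coordinates in the chart at `x₀`. -/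
def frame (x₀ x : M) : E →L[ℝ] TangentSpace I x :=
  (trivializationAt E (TangentSpace I) x₀).symmL ℝ x

theorem mem_baseSet_of_mem_source {x₀ x : M} (hx : x ∈ (chartAt H x₀).source) :
    x ∈ (trivializationAt E (TangentSpace I : M → Type _) x₀).baseSet := by
  simpa using hx

theorem coframe_frame {x₀ x : M} (hx : x ∈ (chartAt H x₀).source) (w : E) :
    coframe (I := I) x₀ x (frame x₀ x w) = w :=
  Trivialization.continuousLinearMapAt_symmL _ (mem_baseSet_of_mem_source hx) w

theorem frame_coframe {x₀ x : M} (hx : x ∈ (chartAt H x₀).source) (v : TangentSpace I x) :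
    frame x₀ x (coframe x₀ x v) = v :=
  Trivialization.symmL_continuousLinearMapAt _ (mem_baseSet_of_mem_source hx) v

theorem coframe_eq_mfderiv {x₀ x : M} (hx : x ∈ (chartAt H x₀).source) (v : TangentSpace I x) :
    coframe x₀ x v = mfderiv I 𝓘(ℝ, E) (extChartAt I x₀) x v :=
  congrArg (fun T : E →L[ℝ] E => T v)
    (TangentBundle.continuousLinearMapAt_trivializationAt (I := I) hx)

theorem inverse_mfderiv_extChartAt {x₀ x : M} (hx : x ∈ (chartAt H x₀).source) (w : E) :
    (mfderiv I 𝓘(ℝ, E) (extChartAt I x₀) x).inverse w = frame x₀ x w := by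
  have h : (mfderiv I 𝓘(ℝ, E) (extChartAt I x₀) x).IsInvertible :=
    isInvertible_mfderiv_extChartAt (by simpa using hx)
  obtain ⟨e, he⟩ := h
  have h1 : coframe x₀ x (frame (I := I) x₀ x w) = e (frame x₀ x w) := by
    rw [coframe_eq_mfderiv hx, ← he]; rfl
  rw [coframe_frame hx] at h1
  rw [← he, ContinuousLinearMap.inverse_equiv]
  exact (e.symm_apply_eq).2 h1

theorem inverse_mfderivWithin_extChartAt_symm {x₀ x : M} (hx : x ∈ (chartAt H x₀).source)
    (v : TangentSpace I x) :
    (show E →L[ℝ] E from mfderivWithin 𝓘(ℝ, E) I (extChartAt I x₀).symm (Set.range I)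
      (extChartAt I x₀ x)).inverse v = coframe x₀ x v := by
  have h0 := TangentBundle.symmL_trivializationAt (I := I) hx
  have hi : (show E →L[ℝ] E from mfderivWithin 𝓘(ℝ, E) I (extChartAt I x₀).symm (Set.range I)
      (extChartAt I x₀ x)).IsInvertible :=
    isInvertible_mfderivWithin_extChartAt_symm ((extChartAt I x₀).map_source (by simpa using hx))
  obtain ⟨e, he⟩ := hi
  rw [← he, ContinuousLinearMap.inverse_equiv]
  refine (e.symm_apply_eq).2 ?_
  have h1 : (e : E →L[ℝ] E) (coframe x₀ x v) = frame (I := I) x₀ x (coframe x₀ x v) := by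
    rw [he]
    exact (congrArg (fun T : E →L[ℝ] E => T (coframe x₀ x v)) h0).symm
  exact (h1.trans (frame_coframe hx v)).symm

omit [IsManifold I ∞ M] in
theorem eventually_mem_source_chart [I.Boundaryless] (x₀ : M) :
    ∀ᶠ z in nhds (extChartAt I x₀ x₀), z ∈ (extChartAt I x₀).target :=
  (isOpen_extChartAt_target x₀).mem_nhds (mem_extChartAt_target x₀)

omit [IsManifold I ∞ M] in
theorem symm_mem_source {x₀ : M} {z : E} (hz : z ∈ (extChartAt I x₀).target) :
    (extChartAt I x₀).symm z ∈ (chartAt H x₀).source := by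
  simpa using (extChartAt I x₀).map_target hz

theorem mpullbackWithin_extChartAt_symm {x₀ : M} {z : E} (hz : z ∈ (extChartAt I x₀).target)
    (X : ∀ x : M, TangentSpace I x) :
    mpullbackWithin 𝓘(ℝ, E) I (extChartAt I x₀).symm X (Set.range I) z
      = coframe x₀ ((extChartAt I x₀).symm z) (X ((extChartAt I x₀).symm z)) := by
  rw [← inverse_mfderivWithin_extChartAt_symm (symm_mem_source hz), mpullbackWithin_apply]
  rw [(extChartAt I x₀).right_inv hz]
  rfl

/-- The matrix, in the chart at `x₀`, of a field of endomorphisms of the tangent spaces. -/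
def endoRep (J : ∀ x : M, TangentSpace I x →L[ℝ] TangentSpace I x) (x₀ : M) (z : E) : E →L[ℝ] E :=
  (coframe x₀ ((extChartAt I x₀).symm z)).comp
    ((J ((extChartAt I x₀).symm z)).comp (frame x₀ ((extChartAt I x₀).symm z)))

theorem endoRep_coframe (J : ∀ x : M, TangentSpace I x →L[ℝ] TangentSpace I x) {x₀ x : M}
    (hx : x ∈ (chartAt H x₀).source) (v : TangentSpace I x) :
    endoRep J x₀ (extChartAt I x₀ x) (coframe x₀ x v) = coframe x₀ x (J x v) := by
  have h : (extChartAt I x₀).symm (extChartAt I x₀ x) = x :=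
    (extChartAt I x₀).left_inv (by simpa using hx)
  change coframe x₀ ((extChartAt I x₀).symm (extChartAt I x₀ x))
    (J _ (frame x₀ ((extChartAt I x₀).symm (extChartAt I x₀ x)) _)) = _
  rw [h, frame_coframe hx]

theorem contDiffAt_comp_extChartAt_symm [I.Boundaryless] {F : Type*} [NormedAddCommGroup F]
    [NormedSpace ℝ F] {f : M → F} {x₀ : M} (hf : ContMDiffAt I 𝓘(ℝ, F) ∞ f x₀) :
    ContDiffAt ℝ ∞ (fun z => f ((extChartAt I x₀).symm z)) (extChartAt I x₀ x₀) := by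
  have h := (contMDiffOn_extChartAt_symm (I := I) (n := ∞) x₀).contMDiffAt
    ((isOpen_extChartAt_target x₀).mem_nhds (mem_extChartAt_target x₀))
  have hf' : ContMDiffAt I 𝓘(ℝ, F) ∞ f ((extChartAt I x₀).symm (extChartAt I x₀ x₀)) := by
    rwa [extChartAt_to_inv]
  exact (hf'.comp _ h).contDiffAt

omit [IsManifold I ∞ M] in
theorem contMDiffAt_comp_extChartAt {F : Type*} [NormedAddCommGroup F]
    [NormedSpace ℝ F] {f : E → F} {x₀ : M} (hf : ContDiffAt ℝ ∞ f (extChartAt I x₀ x₀)) :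
    ContMDiffAt I 𝓘(ℝ, F) ∞ (fun x => f (extChartAt I x₀ x)) x₀ :=
  hf.contMDiffAt.comp x₀ contMDiffAt_extChartAt

theorem contMDiffAt_endo_iff [I.Boundaryless]
    {J : ∀ x : M, TangentSpace I x →L[ℝ] TangentSpace I x} {x₀ : M} :
    ContMDiffAt I (I.prod 𝓘(ℝ, E →L[ℝ] E)) ∞ (fun x => TotalSpace.mk' (E →L[ℝ] E) x (J x)) x₀
      ↔ ContDiffAt ℝ ∞ (endoRep J x₀) (extChartAt I x₀ x₀) := by
  rw [contMDiffAt_hom_bundle]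
  constructor
  · intro h
    exact contDiffAt_comp_extChartAt_symm h.2
  · intro h
    refine ⟨contMDiffAt_id, (contMDiffAt_comp_extChartAt h).congr_of_eventuallyEq ?_⟩
    filter_upwards [(chartAt H x₀).open_source.mem_nhds (mem_chart_source H x₀)] with x hx
    have h : (extChartAt I x₀).symm (extChartAt I x₀ x) = x :=
      (extChartAt I x₀).left_inv (by simpa using hx)
    unfold endoRep
    rw [h]
    rfl

/-- The components, in the chart at `x₀`, of a vector field. -/
def fieldRep (X : ∀ x : M, TangentSpace I x) (x₀ : M) (z : E) : E :=
  coframe x₀ ((extChartAt I x₀).symm z) (X ((extChartAt I x₀).symm z))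

theorem fieldRep_extChartAt (X : ∀ x : M, TangentSpace I x) {x₀ x : M}
    (hx : x ∈ (chartAt H x₀).source) :
    fieldRep X x₀ (extChartAt I x₀ x) = coframe x₀ x (X x) := by
  have h : (extChartAt I x₀).symm (extChartAt I x₀ x) = x :=
    (extChartAt I x₀).left_inv (by simpa using hx)
  unfold fieldRep
  rw [h]

theorem fieldRep_applyField (J : ∀ x : M, TangentSpace I x →L[ℝ] TangentSpace I x)
    (X : ∀ x : M, TangentSpace I x) {x₀ : M} {z : E} (hz : z ∈ (extChartAt I x₀).target) :
    fieldRep (applyField J X) x₀ z = endoRep J x₀ z (fieldRep X x₀ z) := by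
  have := endoRep_coframe J (symm_mem_source hz) (X ((extChartAt I x₀).symm z))
  rw [(extChartAt I x₀).right_inv hz] at this
  exact this.symm

theorem mpullbackWithin_eventuallyEq_fieldRep [I.Boundaryless] (X : ∀ x : M, TangentSpace I x)
    (x₀ : M) :
    (show E → E from mpullbackWithin 𝓘(ℝ, E) I (extChartAt I x₀).symm X (Set.range I))
      =ᶠ[nhds (extChartAt I x₀ x₀)] fieldRep X x₀ := by
  filter_upwards [eventually_mem_source_chart (I := I) x₀] with z hz
  exact mpullbackWithin_extChartAt_symm hz X

theorem differentiableAt_fieldRep [I.Boundaryless] [CompleteSpace E]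
    {X : ∀ x : M, TangentSpace I x} (hX : IsSmoothField X) (x₀ : M) :
    DifferentiableAt ℝ (fieldRep X x₀) (extChartAt I x₀ x₀) := by
  have : IsManifold I 2 M := IsManifold.of_le (n := ∞) ENat.LEInfty.out
  have h := MDifferentiableWithinAt.differentiableWithinAt_mpullbackWithin_vectorField (s := Set.univ)
    (((hX x₀).mdifferentiableAt (by simp)).mdifferentiableWithinAt)
  rw [Set.preimage_univ, Set.univ_inter] at h
  exact (h.differentiableAt (by simp [I.range_eq_univ])).congr_of_eventuallyEq
    (mpullbackWithin_eventuallyEq_fieldRep X x₀).symm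

theorem mlieBracket_eq_frame [I.Boundaryless] (X Y : ∀ x : M, TangentSpace I x) (x₀ : M) :
    mlieBracket I X Y x₀
      = frame x₀ x₀ (lieBracket ℝ (fieldRep X x₀) (fieldRep Y x₀) (extChartAt I x₀ x₀)) := by
  rw [← inverse_mfderiv_extChartAt (mem_chart_source H x₀), ← mlieBracketWithin_univ,
    mlieBracketWithin_apply, ← Filter.EventuallyEq.lieBracket_vectorField_eq
      (mpullbackWithin_eventuallyEq_fieldRep X x₀) (mpullbackWithin_eventuallyEq_fieldRep Y x₀),
    ← lieBracketWithin_univ]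
  have h : (extChartAt I x₀).symm ⁻¹' Set.univ ∩ Set.range I = Set.univ := by
    simp [I.range_eq_univ]
  rw [h]

theorem nijenhuis_eq_frame [I.Boundaryless] [CompleteSpace E]
    {J : ∀ x : M, TangentSpace I x →L[ℝ] TangentSpace I x} {X Y : ∀ x : M, TangentSpace I x}
    (hX : IsSmoothField X) (hY : IsSmoothField Y) {x₀ : M}
    (hJ : DifferentiableAt ℝ (endoRep J x₀) (extChartAt I x₀ x₀)) :
    nijenhuis J X Y x₀ = frame x₀ x₀ (nijenhuisAt (endoRep J x₀) (extChartAt I x₀ x₀)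
      (fieldRep X x₀ (extChartAt I x₀ x₀)) (fieldRep Y x₀ (extChartAt I x₀ x₀))) := by
  have hs := mem_chart_source H x₀
  have hJframe (w : E) : J x₀ (frame x₀ x₀ w)
      = frame x₀ x₀ (endoRep J x₀ (extChartAt I x₀ x₀) w) := by
    conv_rhs => rw [← coframe_frame (I := I) hs w, endoRep_coframe J hs, frame_coframe hs]
  have hrep (Z : ∀ x : M, TangentSpace I x) : fieldRep (applyField J Z) x₀
      =ᶠ[nhds (extChartAt I x₀ x₀)] fun z => endoRep J x₀ z (fieldRep Z x₀ z) := by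
    filter_upwards [eventually_mem_source_chart (I := I) x₀] with z hz
    exact fieldRep_applyField J Z hz
  rw [nijenhuis]
  simp only [mlieBracket_eq_frame, hJframe]
  rw [Filter.EventuallyEq.lieBracket_vectorField_eq (hrep X) (hrep Y),
    Filter.EventuallyEq.lieBracket_vectorField_eq (hrep X) Filter.EventuallyEq.rfl,
    Filter.EventuallyEq.lieBracket_vectorField_eq Filter.EventuallyEq.rfl (hrep Y),
    ← lieBracket_nijenhuis hJ (differentiableAt_fieldRep hX x₀) (differentiableAt_fieldRep hY x₀)]
  simp only [map_sub, map_add]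

end Frame

section Christoffel

variable {E : Type*} [NormedAddCommGroup E] [NormedSpace ℝ E] [FiniteDimensional ℝ E]
  {H : Type*} [TopologicalSpace H] {I : ModelWithCorners ℝ E H}
  {M : Type*} [TopologicalSpace M] [ChartedSpace H M] [IsManifold I ∞ M]

omit [FiniteDimensional ℝ E] in
theorem contMDiffAt_frame {x₀ x : M} (hx : x ∈ (chartAt H x₀).source) (w : E) :
    ContMDiffAt I (I.prod 𝓘(ℝ, E)) ∞
      (fun y => TotalSpace.mk' E (E := (TangentSpace I : M → Type _)) y (frame x₀ y w)) x := by
  have hx' := mem_baseSet_of_mem_source (I := I) hx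
  have hx'' := mem_baseSet_of_mem_source (I := I) (mem_chart_source H x)
  have h := (contMDiffAt_coordChangeL (n := ∞) (IB := I) hx' hx'').clm_apply
    (contMDiffAt_const (c := w))
  refine contMDiffAt_totalSpace.mpr ⟨contMDiffAt_id, h.congr_of_eventuallyEq ?_⟩
  filter_upwards [(trivializationAt E (TangentSpace I) x₀).open_baseSet.mem_nhds hx',
    (trivializationAt E (TangentSpace I) x).open_baseSet.mem_nhds hx''] with b hb hb'
  refine Eq.trans ?_ (Trivialization.coordChangeL_apply' (R := ℝ) _ _ ⟨hb, hb'⟩ w).symm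
  rw [← Trivialization.mk_symm _ hb]
  exact congrArg (fun v => (trivializationAt E (TangentSpace I) x
    (TotalSpace.mk' E (E := (TangentSpace I : M → Type _)) b v)).2)
      (Trivialization.symmL_apply _ hb w)

variable [T2Space M]

/-- The coordinate fields of the chart at `x₀`, cut off away from `x₀`. -/
def globalFrame (x₀ : M) (w : E) : ∀ x : M, TangentSpace I x :=
  (Classical.arbitrary (SmoothBumpFunction I x₀) : M → ℝ) • fun x => frame x₀ x w

theorem isSmoothField_globalFrame (x₀ : M) (w : E) :
    IsSmoothField (globalFrame (I := I) x₀ w) :=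
  ContMDiffOn.smul_section_of_tsupport (u := (chartAt H x₀).source)
    (Classical.arbitrary (SmoothBumpFunction I x₀)).contMDiff.contMDiffOn
    (chartAt H x₀).open_source
    (Classical.arbitrary (SmoothBumpFunction I x₀)).tsupport_subset_chartAt_source
    fun _ hx => (contMDiffAt_frame hx w).contMDiffWithinAt

omit [FiniteDimensional ℝ E] in
omit [T2Space M] in
theorem IsSmoothField.applyField {J : ∀ x : M, TangentSpace I x →L[ℝ] TangentSpace I x}
    (hJ : ContMDiff I (I.prod 𝓘(ℝ, E →L[ℝ] E)) ∞ (fun x => TotalSpace.mk' (E →L[ℝ] E) x (J x)))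
    {X : ∀ x : M, TangentSpace I x} (hX : IsSmoothField X) : IsSmoothField (applyField J X) :=
  ContMDiff.clm_bundle_apply (F₁ := E) (F₂ := E) hJ hX

/-- The Christoffel symbols of a connection in the chart at `x₀`: the components of
`∇_u ∂_w` are `christoffel cov x₀ z w u`. -/
def christoffel (cov : TangentConnection I M) (x₀ : M) (z : E) : E →L[ℝ] E →L[ℝ] E :=
  ∑ i, ((Module.finBasis ℝ E).coord i).toContinuousLinearMap.smulRight
    (endoRep (cov (globalFrame x₀ (Module.finBasis ℝ E i))) x₀ z)

omit [T2Space M] in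
omit [FiniteDimensional ℝ E] [IsManifold I ∞ M] in
theorem eventually_symm_of_eventually [I.Boundaryless] {x₀ : M} {p : M → Prop}
    (hp : ∀ᶠ x in nhds x₀, p x) :
    ∀ᶠ z in nhds (extChartAt I x₀ x₀), p ((extChartAt I x₀).symm z) := by
  have h := continuousAt_extChartAt_symm (I := I) x₀
  rw [ContinuousAt, extChartAt_to_inv] at h
  exact h.eventually hp

omit [T2Space M] in
theorem globalFrame_eventuallyEq (x₀ : M) :
    ∀ᶠ x in nhds x₀, ∀ w : E, globalFrame (I := I) x₀ w x = frame x₀ x w := by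
  filter_upwards [(Classical.arbitrary (SmoothBumpFunction I x₀)).eventuallyEq_one] with x hx w
  simp [globalFrame, hx]

theorem contDiffAt_christoffel [I.Boundaryless] {cov : TangentConnection I M}
    (hcov : CovariantDerivative.ContMDiffCovariantDerivative cov ∞) (x₀ : M) :
    ContDiffAt ℝ ∞ (christoffel cov x₀) (extChartAt I x₀ x₀) := by
  have h (w : E) : ContDiffAt ℝ ∞ (endoRep (cov (globalFrame x₀ w)) x₀) (extChartAt I x₀ x₀) := by
    rw [← contMDiffAt_endo_iff]
    have := hcov.contMDiff.contMDiff (σ := globalFrame x₀ w)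
      (isSmoothField_globalFrame x₀ w).contMDiffOn
    exact (this x₀ (Set.mem_univ _)).contMDiffAt Filter.univ_mem
  exact ContDiffAt.sum fun i _ => contDiffAt_const.smulRight (h _)

omit [T2Space M] in
omit [FiniteDimensional ℝ E] in
theorem contDiffAt_fieldRep [I.Boundaryless] {X : ∀ x : M, TangentSpace I x}
    (hX : IsSmoothField X) (x₀ : M) :
    ContDiffAt ℝ ∞ (fieldRep X x₀) (extChartAt I x₀ x₀) := by
  have h := contDiffAt_comp_extChartAt_symm ((contMDiffAt_section x₀).1 (hX x₀))
  refine h.congr_of_eventuallyEq ?_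
  filter_upwards [eventually_mem_source_chart (I := I) x₀] with z hz
  exact congrFun (Trivialization.coe_linearMapAt_of_mem (R := ℝ) _
    (mem_baseSet_of_mem_source (symm_mem_source hz))) _

omit [T2Space M] in
omit [FiniteDimensional ℝ E] in
theorem cov_sum_smul (cov : TangentConnection I M) {ι : Type*} (s : Finset ι)
    {c : ι → M → ℝ} {X : ι → ∀ x : M, TangentSpace I x} {x : M}
    (hc : ∀ i, MDifferentiableAt I 𝓘(ℝ) (c i) x) (hX : ∀ i, IsSmoothField (X i)) :
    cov (∑ i ∈ s, c i • X i) x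
      = ∑ i ∈ s, (c i x • cov (X i) x + (mvfderiv I (c i) x).smulRight (X i x)) := by
  classical
  have hX' (i : ι) : MDiffAt (T% (X i)) x := (hX i x).mdifferentiableAt (by simp)
  induction s using Finset.induction_on with
  | empty => simp
  | insert i s hi h =>
    rw [Finset.sum_insert hi, Finset.sum_insert hi, ← h,
      ← cov.isCovariantDerivativeOnUniv.leibniz (hX' i) (hc i)]
    refine cov.isCovariantDerivativeOnUniv.add ((hc i).smul_section (hX' i)) ?_
    have := MDifferentiableAt.sum_section (s := s) (t := fun i => c i • X i)
      fun j _ => (hc j).smul_section (hX' j)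
    simpa using! this

theorem endoRep_cov_eq [I.Boundaryless] (cov : TangentConnection I M)
    {X : ∀ x : M, TangentSpace I x} (hX : IsSmoothField X) (x₀ : M) :
    ∀ᶠ z in nhds (extChartAt I x₀ x₀), ∀ u : E, endoRep (cov X) x₀ z u
      = fderiv ℝ (fieldRep X x₀) z u + christoffel cov x₀ z (fieldRep X x₀ z) u := by
  have hd : ∀ᶠ z in nhds (extChartAt I x₀ x₀), DifferentiableAt ℝ (fieldRep X x₀) z := by
    filter_upwards [((contDiffAt_fieldRep hX x₀).of_le (m := 1) (by simp)).eventually (by simp)]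
      with z hz using hz.differentiableAt one_ne_zero
  filter_upwards [eventually_mem_source_chart (I := I) x₀, hd,
    eventually_symm_of_eventually (globalFrame_eventuallyEq (I := I) x₀).eventually_nhds]
    with z hz hdz hfr u
  set x := (extChartAt I x₀).symm z with hxdef
  have hx : x ∈ (chartAt H x₀).source := symm_mem_source hz
  have hzx : extChartAt I x₀ x = z := (extChartAt I x₀).right_inv hz
  let b := Module.finBasis ℝ E
  let c (i : Fin (Module.finrank ℝ E)) (y : M) : ℝ :=
    (b.coord i).toContinuousLinearMap (fieldRep X x₀ (extChartAt I x₀ y))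
  have hφ : HasMFDerivAt I 𝓘(ℝ, E) (extChartAt I x₀) x (mfderiv I 𝓘(ℝ, E) (extChartAt I x₀) x) :=
    (mdifferentiableAt_extChartAt hx).hasMFDerivAt
  have hcd (i) : HasMFDerivAt I 𝓘(ℝ) (c i) x (((b.coord i).toContinuousLinearMap.comp
      (fderiv ℝ (fieldRep X x₀) z)).comp (coframe x₀ x)) := by
    have h1 : HasFDerivAt (fun z => (b.coord i).toContinuousLinearMap (fieldRep X x₀ z))
        ((b.coord i).toContinuousLinearMap.comp (fderiv ℝ (fieldRep X x₀) z))
        (extChartAt I x₀ x) := by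
      rw [hzx]
      exact ((b.coord i).toContinuousLinearMap.hasFDerivAt).comp z hdz.hasFDerivAt
    have h2 := h1.hasMFDerivAt.comp x hφ
    have h3 : (coframe x₀ x : TangentSpace I x →L[ℝ] E) = mfderiv I 𝓘(ℝ, E) (extChartAt I x₀) x :=
      ContinuousLinearMap.ext fun v => coframe_eq_mfderiv hx v
    rw [h3]
    exact h2
  have hX' : cov X x = cov (∑ i, c i • globalFrame x₀ (b i)) x := by
    refine cov.isCovariantDerivativeOnUniv.congr_of_eventuallyEq
      ((hX x).mdifferentiableAt (by simp)) ?_ Filter.univ_mem ?_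
    · have := MDifferentiableAt.sum_section (s := Finset.univ)
        (t := fun i => c i • globalFrame x₀ (b i)) (x₀ := x) fun j _ =>
          (hcd j).mdifferentiableAt.smul_section
            ((isSmoothField_globalFrame (I := I) x₀ (b j) x).mdifferentiableAt (by simp))
      simpa using! this
    · filter_upwards [hfr, (chartAt H x₀).open_source.mem_nhds hx] with y hy hys
      have h1 : (∑ i, c i • globalFrame (I := I) x₀ (b i)) y = ∑ i, c i y • frame x₀ y (b i) := by
        simp [hy]
      rw [h1]
      simp only [← map_smul, ← map_sum]
      have h2 : ∑ i, c i y • b i = coframe x₀ y (X y) := by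
        simp only [c, fieldRep_extChartAt X hys]
        exact b.sum_repr _
      rw [h2, frame_coframe hys]
  have hmv (i) : mvfderiv I (c i) x = ((b.coord i).toContinuousLinearMap.comp
      (fderiv ℝ (fieldRep X x₀) z)).comp (coframe x₀ x) := (hcd i).mfderiv
  change coframe x₀ x (cov X x (frame x₀ x u)) = _
  rw [hX', cov_sum_smul cov _ (fun i => (hcd i).mdifferentiableAt)
    (fun i => isSmoothField_globalFrame x₀ (b i))]
  simp only [hmv, hfr.self_of_nhds, sum_apply, add_apply, map_sum, map_add, smul_apply, map_smul,
    ContinuousLinearMap.smulRight_apply, ContinuousLinearMap.comp_apply, coframe_frame hx,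
    Finset.sum_add_distrib]
  rw [add_comm]
  congr 1
  · exact b.sum_repr _
  · simp only [christoffel, sum_apply, ContinuousLinearMap.smulRight_apply, smul_apply, c, hzx]
    rfl

omit [T2Space M] in
theorem fieldRep_globalFrame [I.Boundaryless] (x₀ : M) :
    ∀ᶠ z in nhds (extChartAt I x₀ x₀), ∀ w : E, fieldRep (globalFrame (I := I) x₀ w) x₀ z = w := by
  filter_upwards [eventually_mem_source_chart (I := I) x₀,
    eventually_symm_of_eventually (globalFrame_eventuallyEq (I := I) x₀)] with z hz h w
  rw [fieldRep, h, coframe_frame (symm_mem_source hz)]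

theorem eventually_forall_of_basis {E F : Type*} [NormedAddCommGroup E] [NormedSpace ℝ E]
    [FiniteDimensional ℝ E] [NormedAddCommGroup F] [NormedSpace ℝ F] {α : Type*} {l : Filter α}
    {S T : α → E →L[ℝ] F} (h : ∀ w, ∀ᶠ z in l, S z w = T z w) : ∀ᶠ z in l, ∀ w, S z w = T z w := by
  have h' : ∀ᶠ z in l, ∀ i, S z (Module.finBasis ℝ E i) = T z (Module.finBasis ℝ E i) :=
    Filter.eventually_all.2 fun i => h _
  filter_upwards [h'] with z hz w
  have : (S z : E →ₗ[ℝ] F) = T z := (Module.finBasis ℝ E).ext hz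
  exact congrArg (fun f : E →ₗ[ℝ] F => f w) this

theorem endoRep_cov_globalFrame [I.Boundaryless] (cov : TangentConnection I M) (x₀ : M) (w : E) :
    ∀ᶠ z in nhds (extChartAt I x₀ x₀), endoRep (cov (globalFrame x₀ w)) x₀ z
      = christoffel cov x₀ z w := by
  filter_upwards [endoRep_cov_eq cov (isSmoothField_globalFrame (I := I) x₀ w) x₀,
    (fieldRep_globalFrame (I := I) x₀).eventually_nhds] with z h1 h2
  ext u
  have h3 : fieldRep (globalFrame (I := I) x₀ w) x₀ =ᶠ[nhds z] fun _ => w :=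
    h2.mono fun y hy => hy w
  rw [h1 u, h3.fderiv_eq, h3.self_of_nhds]
  simp

theorem fderiv_endoRep_of_isParallel [I.Boundaryless] {cov : TangentConnection I M}
    {J : ∀ x : M, TangentSpace I x →L[ℝ] TangentSpace I x}
    (hJ : ContMDiff I (I.prod 𝓘(ℝ, E →L[ℝ] E)) ∞ (fun x => TotalSpace.mk' (E →L[ℝ] E) x (J x)))
    (hpar : IsParallel cov J) (x₀ : M) :
    ∀ᶠ z in nhds (extChartAt I x₀ x₀), ∀ w u : E, fderiv ℝ (endoRep J x₀) z u w
      = endoRep J x₀ z (christoffel cov x₀ z w u)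
        - christoffel cov x₀ z (endoRep J x₀ z w) u := by
  have hd : ∀ᶠ z in nhds (extChartAt I x₀ x₀), DifferentiableAt ℝ (endoRep J x₀) z := by
    filter_upwards [((contMDiffAt_endo_iff.1 (hJ x₀)).of_le (m := 1) (by simp)).eventually (by simp)]
      with z hz using hz.differentiableAt one_ne_zero
  have key (w : E) : ∀ᶠ z in nhds (extChartAt I x₀ x₀), (fderiv ℝ (endoRep J x₀) z).flip w
      = (((ContinuousLinearMap.compL ℝ E E E (endoRep J x₀ z)).comp (christoffel cov x₀ z))
          - (christoffel cov x₀ z).comp (endoRep J x₀ z)) w := by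
    have hY := isSmoothField_globalFrame (I := I) x₀ w
    filter_upwards [hd, endoRep_cov_eq cov (hY.applyField hJ) x₀, endoRep_cov_globalFrame cov x₀ w,
      eventually_mem_source_chart (I := I) x₀,
      (eventually_mem_source_chart (I := I) x₀).eventually_nhds,
      (fieldRep_globalFrame (I := I) x₀).eventually_nhds] with z hdz h1 h2 hz hz' h3
    ext u
    have h4 : fieldRep (applyField J (globalFrame (I := I) x₀ w)) x₀
        =ᶠ[nhds z] fun y => endoRep J x₀ y w := by
      filter_upwards [hz', h3] with y hy hy3
      rw [fieldRep_applyField J _ hy, hy3]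
    have h5 := h1 u
    rw [h4.fderiv_eq, h4.self_of_nhds, fderiv_clm_apply hdz (differentiableAt_const w)] at h5
    have h6 : endoRep (cov (applyField J (globalFrame x₀ w))) x₀ z u
        = endoRep J x₀ z (endoRep (cov (globalFrame x₀ w)) x₀ z u) := by
      set x := (extChartAt I x₀).symm z with hxdef
      change coframe x₀ x (cov _ x (frame x₀ x u))
        = coframe x₀ x (J x (frame x₀ x (coframe x₀ x (cov _ x (frame x₀ x u)))))
      rw [frame_coframe (symm_mem_source hz), hpar _ hY]
    rw [h6, h2] at h5
    simp at h5 ⊢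
    rw [h5]
    abel
  filter_upwards [eventually_forall_of_basis key] with z hz w u
  exact congrArg (fun T : E →L[ℝ] E => T u) (hz w)

omit [T2Space M] in
theorem mlieBracket_globalFrame (x₀ : M) (u w : E) :
    ∀ᶠ x in nhds x₀, mlieBracket I (globalFrame (I := I) x₀ u) (globalFrame x₀ w) x = 0 := by
  have : IsManifold I (minSmoothness ℝ 2) M := by
    rw [minSmoothness_of_isRCLikeNormedField]
    exact IsManifold.of_le (n := ∞) ENat.LEInfty.out
  filter_upwards [(globalFrame_eventuallyEq (I := I) x₀).eventually_nhds,
    (chartAt H x₀).open_source.mem_nhds (mem_chart_source H x₀)] with x h hx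
  have hp (v : E) : globalFrame (I := I) x₀ v =ᶠ[nhds x]
      mpullback I 𝓘(ℝ, E) (extChartAt I x₀) (fun _ => v) := by
    filter_upwards [h, (chartAt H x₀).open_source.mem_nhds hx] with y hy hys
    exact (hy v).trans (inverse_mfderiv_extChartAt hys v).symm
  have hconst (v : E) : MDifferentiableAt 𝓘(ℝ, E) (𝓘(ℝ, E).prod 𝓘(ℝ, E))
      (fun y : E => TotalSpace.mk' E (E := (TangentSpace 𝓘(ℝ, E) : E → Type _)) y v)
      (extChartAt I x₀ x) := by
    rw [mdifferentiableAt_totalSpace]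
    refine ⟨mdifferentiableAt_id, ?_⟩
    simpa using! mdifferentiableAt_const
  rw [(hp u).mlieBracket_vectorField_eq (hp w), ← mpullback_mlieBracket (n := ∞)
    (hconst u) (hconst w) (contMDiffAt_extChartAt' hx) (by simpa using! ENat.LEInfty.out)]
  have h0 : mlieBracketWithin 𝓘(ℝ, E) (fun _ : E => u) (fun _ => w) Set.univ
      (extChartAt I x₀ x) = 0 := by
    refine (congrFun mlieBracketWithin_eq_lieBracketWithin _).trans ?_
    simp [lieBracketWithin]
    rfl
  exact (congrArg (mfderiv I 𝓘(ℝ, E) (extChartAt I x₀) x).inverse h0).trans (map_zero _)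

theorem christoffel_symm [I.Boundaryless] {cov : TangentConnection I M}
    (htor : cov.torsion = 0) (x₀ : M) :
    ∀ᶠ z in nhds (extChartAt I x₀ x₀), ∀ u w : E,
      christoffel cov x₀ z u w = christoffel cov x₀ z w u := by
  have key (u w : E) : ∀ᶠ z in nhds (extChartAt I x₀ x₀),
      christoffel cov x₀ z u w = (christoffel cov x₀ z).flip u w := by
    filter_upwards [endoRep_cov_globalFrame cov x₀ w, endoRep_cov_globalFrame cov x₀ u,
      eventually_symm_of_eventually (mlieBracket_globalFrame (I := I) x₀ u w),
      eventually_symm_of_eventually (globalFrame_eventuallyEq (I := I) x₀)] with z h1 h2 h3 h4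
    have h5 := (CovariantDerivative.torsion_eq_zero_iff cov).1 htor
      (((isSmoothField_globalFrame (I := I) x₀ u) ((extChartAt I x₀).symm z)).mdifferentiableAt
        (by simp))
      (((isSmoothField_globalFrame (I := I) x₀ w) ((extChartAt I x₀).symm z)).mdifferentiableAt
        (by simp))
    rw [h3, h4, h4, sub_eq_zero] at h5
    rw [ContinuousLinearMap.flip_apply, ← h1, ← h2]
    exact (congrArg (coframe x₀ ((extChartAt I x₀).symm z)) h5).symm
  have key' (u : E) : ∀ᶠ z in nhds (extChartAt I x₀ x₀),
      christoffel cov x₀ z u = (christoffel cov x₀ z).flip u := by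
    filter_upwards [eventually_forall_of_basis (key u)] with z hz
    exact ContinuousLinearMap.ext hz
  filter_upwards [eventually_forall_of_basis key'] with z hz u w
  exact congrArg (fun T : E →L[ℝ] E => T w) (hz u)

theorem nijenhuisAt_endoRep_of_isParallel [I.Boundaryless] {cov : TangentConnection I M}
    {J : ∀ x : M, TangentSpace I x →L[ℝ] TangentSpace I x}
    (hJ : ContMDiff I (I.prod 𝓘(ℝ, E →L[ℝ] E)) ∞ (fun x => TotalSpace.mk' (E →L[ℝ] E) x (J x)))
    (hpar : IsParallel cov J) (htor : cov.torsion = 0) (x₀ : M) :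
    ∀ᶠ z in nhds (extChartAt I x₀ x₀), ∀ a w : E, nijenhuisAt (endoRep J x₀) z a w = 0 := by
  filter_upwards [fderiv_endoRep_of_isParallel hJ hpar x₀, christoffel_symm htor x₀] with z h hs a w
  simp only [nijenhuisAt, h, map_sub, hs a, hs (endoRep J x₀ z a)]
  abel

end Christoffel

section CotangentCoordinates

variable {E : Type*} [NormedAddCommGroup E] [NormedSpace ℝ E]
  {H : Type*} [TopologicalSpace H] {I : ModelWithCorners ℝ E H}
  {M : Type*} [TopologicalSpace M] [ChartedSpace H M] [IsManifold I ∞ M]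

theorem fibreCoord_apply (x₀ : M) (b : CotangentBundle I M) (w : E) :
    fibreCoord x₀ b w = b.2 (frame x₀ b.proj w) := by
  change ((trivializationAt ℝ (Bundle.Trivial M ℝ) x₀).continuousLinearMapAt ℝ b.proj)
    (b.2 (frame x₀ b.proj w)) = _
  simp

theorem mem_chart_source_cotangent {a₀ b : CotangentBundle I M}
    (hb : b.proj ∈ (chartAt H a₀.proj).source) :
    b ∈ (chartAt (ModelProd H (E →L[ℝ] ℝ)) a₀).source := by
  rw [FiberBundle.chartedSpace_chartAt]
  have h := mem_baseSet_of_mem_source (I := I) hb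
  simp [hb]

theorem extChartAt_cotangent (a₀ b : CotangentBundle I M) :
    extChartAt (cotangentModel I) a₀ b
      = (extChartAt I a₀.proj b.proj, fibreCoord a₀.proj b) := by
  rw [FiberBundle.extChartAt]
  rfl

theorem mdifferentiableAt_fibreCoord {x₀ : M} {b : CotangentBundle I M}
    (hb : b.proj ∈ (chartAt H x₀).source) :
    MDifferentiableAt (cotangentModel I) 𝓘(ℝ, E →L[ℝ] ℝ) (fibreCoord (I := I) x₀) b := by
  have h := mdifferentiableAt_extChartAt (I := cotangentModel I)
    (mem_chart_source_cotangent (a₀ := (⟨x₀, 0⟩ : CotangentBundle I M)) hb)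
  have h2 : MDifferentiableAt (cotangentModel I) 𝓘(ℝ, E →L[ℝ] ℝ)
      (fun c => (extChartAt (cotangentModel I) (⟨x₀, 0⟩ : CotangentBundle I M) c).2) b :=
    (differentiableAt_snd.mdifferentiableAt).comp b h
  refine h2.congr_of_eventuallyEq ?_
  exact Filter.Eventually.of_forall fun c => by rw [FiberBundle.extChartAt]; rfl

theorem coframe_cotangent {a₀ b : CotangentBundle I M} (hb : b.proj ∈ (chartAt H a₀.proj).source)
    (A : TangentSpace (cotangentModel I) b) :
    coframe a₀ b A = (coframe a₀.proj b.proj (projTangent b A),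
      (mfderiv (cotangentModel I) 𝓘(ℝ, E →L[ℝ] ℝ) (fibreCoord (I := I) a₀.proj) b A
        : E →L[ℝ] ℝ)) := by
  have hp : MDifferentiableAt (cotangentModel I) I (fun c : CotangentBundle I M => c.proj) b :=
    mdifferentiableAt_proj (fun x : M => TangentSpace I x →L[ℝ] ℝ)
  have hφ : MDifferentiableAt I 𝓘(ℝ, E) (extChartAt I a₀.proj) b.proj :=
    mdifferentiableAt_extChartAt hb
  have h1 := hφ.hasMFDerivAt.comp b hp.hasMFDerivAt
  have h2 := (mdifferentiableAt_fibreCoord (I := I) hb).hasMFDerivAt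
  have hψ := (mdifferentiableAt_extChartAt (I := cotangentModel I)
    (mem_chart_source_cotangent hb)).hasMFDerivAt
  have h3 := ((ContinuousLinearMap.fst ℝ E (E →L[ℝ] ℝ)).hasFDerivAt
    (x := extChartAt (cotangentModel I) a₀ b)).hasMFDerivAt.comp b hψ
  have h4 := ((ContinuousLinearMap.snd ℝ E (E →L[ℝ] ℝ)).hasFDerivAt
    (x := extChartAt (cotangentModel I) a₀ b)).hasMFDerivAt.comp b hψ
  have e3 : ContinuousLinearMap.fst ℝ E (E →L[ℝ] ℝ) ∘ extChartAt (cotangentModel I) a₀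
      = extChartAt I a₀.proj ∘ fun c : CotangentBundle I M => c.proj := by
    funext c
    rw [FiberBundle.extChartAt]
    rfl
  have e4 : ContinuousLinearMap.snd ℝ E (E →L[ℝ] ℝ) ∘ extChartAt (cotangentModel I) a₀
      = fibreCoord (I := I) a₀.proj := by
    funext c
    rw [FiberBundle.extChartAt]
    rfl
  rw [e3] at h3
  rw [e4] at h4
  rw [coframe_eq_mfderiv (mem_chart_source_cotangent hb), coframe_eq_mfderiv hb]
  exact Prod.ext
    (congrArg (fun T : (E × (E →L[ℝ] ℝ)) →L[ℝ] E => T A) (hasMFDerivAt_unique h3 h1))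
    (congrArg (fun T : (E × (E →L[ℝ] ℝ)) →L[ℝ] (E →L[ℝ] ℝ) => T A) (hasMFDerivAt_unique h4 h2))

theorem coframe_verticalLift {a₀ b : CotangentBundle I M}
    (hb : b.proj ∈ (chartAt H a₀.proj).source) (β : Cotangent I b.proj) :
    coframe a₀ b (verticalLift b β) = (0, β.comp (frame a₀.proj b.proj)) := by
  rw [coframe_cotangent hb, projTangent_verticalLift, map_zero]
  refine Prod.ext rfl ?_
  have h := mfderiv_comp (M := E →L[ℝ] ℝ) (I := 𝓘(ℝ, E →L[ℝ] ℝ)) (I' := cotangentModel I)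
    (I'' := 𝓘(ℝ, E →L[ℝ] ℝ)) b.2 (g := fibreCoord (I := I) a₀.proj)
    (mdifferentiableAt_fibreCoord hb) (mdifferentiableAt_fibreInclusion b)
  let L : (E →L[ℝ] ℝ) →L[ℝ] (E →L[ℝ] ℝ) :=
    ContinuousLinearMap.precomp ℝ (show E →L[ℝ] E from frame (I := I) a₀.proj b.proj)
  have hc : (fibreCoord (I := I) a₀.proj ∘ (fun β : E →L[ℝ] ℝ =>
      (TotalSpace.mk' (E →L[ℝ] ℝ) b.proj β : CotangentBundle I M))) = L := by
    funext β
    exact ContinuousLinearMap.ext fun w => fibreCoord_apply _ _ w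
  rw [hc] at h
  have h' : (L : (E →L[ℝ] ℝ) →L[ℝ] (E →L[ℝ] ℝ)) = _ :=
    (mfderiv_eq_fderiv.trans (ContinuousLinearMap.fderiv L)).symm.trans h
  exact (congrArg (fun T : (E →L[ℝ] ℝ) →L[ℝ] (E →L[ℝ] ℝ) => T β) h').symm

end CotangentCoordinates

section Lift

variable {E : Type*} [NormedAddCommGroup E] [NormedSpace ℝ E] [FiniteDimensional ℝ E]
  {H : Type*} [TopologicalSpace H] {I : ModelWithCorners ℝ E H}
  {M : Type*} [TopologicalSpace M] [ChartedSpace H M] [IsManifold I ∞ M] [T2Space M]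

omit [T2Space M] in
theorem christoffel_basis (cov : TangentConnection I M) (x₀ : M) (z : E)
    (i : Fin (Module.finrank ℝ E)) :
    christoffel cov x₀ z (Module.finBasis ℝ E i)
      = endoRep (cov (globalFrame x₀ (Module.finBasis ℝ E i))) x₀ z := by
  simp [christoffel, Finsupp.single_apply]

theorem coframe_horizontalLift (cov : TangentConnection I M) {a₀ b : CotangentBundle I M}
    (hb : b.proj ∈ (chartAt H a₀.proj).source)
    (hfr : ∀ᶠ x in nhds b.proj, ∀ w : E, globalFrame (I := I) a₀.proj w x = frame a₀.proj x w)
    (v : TangentSpace I b.proj) :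
    coframe a₀ b (horizontalLift cov b v) = (coframe a₀.proj b.proj v, (fibreCoord a₀.proj b).comp
      ((christoffel cov a₀.proj (extChartAt I a₀.proj b.proj)).flip
        (coframe a₀.proj b.proj v))) := by
  let α := extendCovector b
  have hα := mdifferentiableAt_extendCovector b
  have hαx : α.toMap b.proj = b := by simp [α, OneForm.toMap, extendCovector]
  have hαx' : α b.proj = b.2 := by simp [α, extendCovector]
  refine Prod.ext ?_ ?_
  · rw [coframe_cotangent hb, projTangent_horizontalLift]
  let b' := Module.finBasis ℝ E
  suffices h : ∀ i, (coframe a₀ b (horizontalLift cov b v)).2 (b' i)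
      = ((fibreCoord a₀.proj b).comp ((christoffel cov a₀.proj (extChartAt I a₀.proj b.proj)).flip
        (coframe a₀.proj b.proj v))) (b' i) from
    ContinuousLinearMap.coe_injective (b'.ext h)
  intro i
  set w := b' i
  let A : TangentSpace (cotangentModel I) b := mfderiv I (cotangentModel I) α.toMap b.proj v
  have hlift : horizontalLift cov b v = A - verticalLift b (dualDeriv cov α b.proj hα v) := rfl
  have hA : (coframe a₀ b A).2 w = mvfderiv I (fun y => α y (globalFrame a₀.proj w y)) b.proj v := by
    have hfc : MDifferentiableAt (cotangentModel I) 𝓘(ℝ, E →L[ℝ] ℝ) (fibreCoord (I := I) a₀.proj)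
        (α.toMap b.proj) := by
      rw [hαx]; exact mdifferentiableAt_fibreCoord hb
    have h1 := (hfc.hasMFDerivAt.comp b.proj hα.hasMFDerivAt)
    have h2 := ((ContinuousLinearMap.apply ℝ ℝ w).hasFDerivAt
      (x := fibreCoord (I := I) a₀.proj (α.toMap b.proj))).hasMFDerivAt.comp b.proj h1
    have h3 : (fun y => α y (globalFrame a₀.proj w y)) =ᶠ[nhds b.proj]
        (ContinuousLinearMap.apply ℝ ℝ w) ∘ (fibreCoord (I := I) a₀.proj ∘ α.toMap) := by
      filter_upwards [hfr] with y hy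
      rw [hy]
      exact (fibreCoord_apply a₀.proj (α.toMap y) w).symm
    have h4 := (h2.congr_of_eventuallyEq h3).mfderiv
    rw [coframe_cotangent hb]
    have h5 := congrArg (fun T : E →L[ℝ] ℝ => T v) h4
    refine Eq.trans ?_ h5.symm
    change (show (E × (E →L[ℝ] ℝ)) →L[ℝ] (E →L[ℝ] ℝ) from mfderiv (cotangentModel I)
        𝓘(ℝ, E →L[ℝ] ℝ) (fibreCoord (I := I) a₀.proj) b) _ w
      = (show (E × (E →L[ℝ] ℝ)) →L[ℝ] (E →L[ℝ] ℝ) from mfderiv (cotangentModel I)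
        𝓘(ℝ, E →L[ℝ] ℝ) (fibreCoord (I := I) a₀.proj) (α.toMap b.proj)) _ w
    rw [hαx]
    rfl
  have hdual : dualDeriv cov α b.proj hα v (frame a₀.proj b.proj w)
      = mvfderiv I (fun y => α y (globalFrame a₀.proj w y)) b.proj v
        - b.2 (cov (globalFrame a₀.proj w) b.proj v) := by
    have h1 : frame a₀.proj b.proj w = globalFrame (I := I) a₀.proj w b.proj := (hfr.self_of_nhds w).symm
    rw [h1, dualDeriv, TensorialAt.mkHom_apply _
      ((isSmoothField_globalFrame a₀.proj w b.proj).mdifferentiableAt (by simp))]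
    rw [← hαx']
    rfl
  rw [hlift, ContinuousLinearMap.map_sub, Prod.snd_sub, sub_apply, hA, coframe_verticalLift hb]
  change _ - dualDeriv cov α b.proj hα v (frame a₀.proj b.proj w) = _
  rw [hdual, sub_sub_cancel, ContinuousLinearMap.comp_apply, ContinuousLinearMap.flip_apply,
    christoffel_basis, endoRep_coframe _ hb, fibreCoord_apply, frame_coframe hb]

theorem coframe_PhiEquiv (cov : TangentConnection I M) {a₀ b : CotangentBundle I M}
    (hb : b.proj ∈ (chartAt H a₀.proj).source)
    (hfr : ∀ᶠ x in nhds b.proj, ∀ w : E, globalFrame (I := I) a₀.proj w x = frame a₀.proj x w)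
    (s : TangentSpace I b.proj × Cotangent I b.proj) :
    coframe a₀ b (PhiEquiv cov b s) = (coframe a₀.proj b.proj s.1,
      s.2.comp (frame a₀.proj b.proj) + (fibreCoord a₀.proj b).comp
      ((christoffel cov a₀.proj (extChartAt I a₀.proj b.proj)).flip
        (coframe a₀.proj b.proj s.1))) := by
  have h : PhiEquiv cov b s = horizontalLift cov b s.1 + verticalLift b s.2 := rfl
  rw [h, ContinuousLinearMap.map_add, coframe_horizontalLift cov hb hfr, coframe_verticalLift hb, Prod.mk_add_mk,
    add_zero, add_comm (s.2.comp _)]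

omit [FiniteDimensional ℝ E] [T2Space M] in
theorem eventually_proj {a₀ : CotangentBundle I M} {p : M → Prop}
    (hp : ∀ᶠ x in nhds a₀.proj, p x) : ∀ᶠ b in nhds a₀, p b.proj :=
  (FiberBundle.continuous_proj (E →L[ℝ] ℝ)
    (fun x : M => TangentSpace I x →L[ℝ] ℝ)).continuousAt.eventually hp

theorem endoRep_liftedJ [I.Boundaryless] {cov : TangentConnection I M}
    {J : ∀ x : M, TangentSpace I x →L[ℝ] TangentSpace I x}
    (hJ : ContMDiff I (I.prod 𝓘(ℝ, E →L[ℝ] E)) ∞ (fun x => TotalSpace.mk' (E →L[ℝ] E) x (J x)))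
    (hpar : IsParallel cov J) (htor : cov.torsion = 0) (a₀ : CotangentBundle I M) :
    endoRep (liftedJ cov J) a₀ =ᶠ[nhds (extChartAt (cotangentModel I) a₀ a₀)]
      cotangentLift (endoRep J a₀.proj) := by
  have hφ : ∀ᶠ x in nhds a₀.proj, x ∈ (chartAt H a₀.proj).source :=
    (chartAt H a₀.proj).open_source.mem_nhds (mem_chart_source H a₀.proj)
  have hc := continuousAt_extChartAt (I := I) a₀.proj
  filter_upwards [eventually_mem_source_chart (I := cotangentModel I) a₀,
    eventually_symm_of_eventually (I := cotangentModel I) (eventually_proj hφ),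
    eventually_symm_of_eventually (I := cotangentModel I)
      (eventually_proj (globalFrame_eventuallyEq (I := I) a₀.proj).eventually_nhds),
    eventually_symm_of_eventually (I := cotangentModel I)
      (eventually_proj (hc.eventually (fderiv_endoRep_of_isParallel hJ hpar a₀.proj))),
    eventually_symm_of_eventually (I := cotangentModel I)
      (eventually_proj (hc.eventually (christoffel_symm htor a₀.proj)))] with z hz hb hfr hd hs
  set b := (extChartAt (cotangentModel I) a₀).symm z with hbdef
  have hzb : extChartAt (cotangentModel I) a₀ b = z := (extChartAt _ a₀).right_inv hz
  have hb' := mem_chart_source_cotangent hb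
  refine ContinuousLinearMap.ext fun B => ?_
  obtain ⟨s, hs'⟩ := (PhiEquiv cov b).surjective (frame a₀ b B)
  have hB : coframe a₀ b (PhiEquiv cov b s) = B := by rw [hs', coframe_frame hb']
  have hlift : liftedJ cov J b (PhiEquiv cov b s) = PhiEquiv cov b (generalizedJ J b.proj s) := by
    change PhiEquiv cov b (generalizedJ J b.proj ((PhiEquiv cov b).symm (PhiEquiv cov b s))) = _
    rw [ContinuousLinearEquiv.symm_apply_apply]
  rw [← hzb, ← hB, endoRep_coframe _ hb', hlift, coframe_PhiEquiv cov hb hfr,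
    coframe_PhiEquiv cov hb hfr, extChartAt_cotangent a₀ b]
  refine Prod.ext ?_ (ContinuousLinearMap.ext fun w => ?_)
  · exact (endoRep_coframe J hb s.1).symm
  · have h1 : (generalizedJ J b.proj s).1 = J b.proj s.1 := rfl
    have h2 : ((generalizedJ J b.proj s).2.comp (frame a₀.proj b.proj)) w
        = s.2 (frame a₀.proj b.proj (endoRep J a₀.proj (extChartAt I a₀.proj b.proj) w)) := by
      conv_rhs => rw [← coframe_frame (I := I) hb w, endoRep_coframe J hb, frame_coframe hb]
      rfl
    rw [cotangentLift_apply_snd, h1, ← endoRep_coframe J hb]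
    simp only [add_apply, h2, ContinuousLinearMap.comp_apply, ContinuousLinearMap.flip_apply, hd,
      map_sub]
    rw [hs w, hs w]
    ring

end Lift

section Metric

variable {E : Type*} [NormedAddCommGroup E] [NormedSpace ℝ E] [FiniteDimensional ℝ E]
  {H : Type*} [TopologicalSpace H] {I : ModelWithCorners ℝ E H}
  {M : Type*} [TopologicalSpace M] [ChartedSpace H M] [IsManifold I ∞ M]

theorem inner_sharp (g : TangentMetric I M) (x : M) (β : Cotangent I x) (w : TangentSpace I x) :
    g.inner x (sharp g x β) w = β w :=
  congrArg (fun φ : Cotangent I x => φ w)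
    ((LinearEquiv.ofBijective (g.inner x).toLinearMap (flat_bijective g x)).apply_symm_apply β)

/-- The matrix of a Riemannian metric in the chart at `x₀`. -/
def metricRep (g : TangentMetric I M) (x₀ : M) (z : E) : E →L[ℝ] E →L[ℝ] ℝ :=
  (ContinuousLinearMap.precomp ℝ (frame x₀ ((extChartAt I x₀).symm z))).comp
    ((g.inner ((extChartAt I x₀).symm z)).comp (frame x₀ ((extChartAt I x₀).symm z)))

omit [FiniteDimensional ℝ E] in
theorem metricRep_extChartAt (g : TangentMetric I M) {x₀ x : M} (hx : x ∈ (chartAt H x₀).source)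
    (u w : E) : metricRep g x₀ (extChartAt I x₀ x) u w
      = g.inner x (frame x₀ x u) (frame x₀ x w) := by
  have h : (extChartAt I x₀).symm (extChartAt I x₀ x) = x :=
    (extChartAt I x₀).left_inv (by simpa using hx)
  change g.inner ((extChartAt I x₀).symm (extChartAt I x₀ x)) (frame x₀ _ u) (frame x₀ _ w) = _
  rw [h]

omit [FiniteDimensional ℝ E] in
theorem inCoordinates_bilinear {x₀ x : M} (hx : x ∈ (chartAt H x₀).source)
    (B : TangentSpace I x →L[ℝ] TangentSpace I x →L[ℝ] ℝ) (u w : E) :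
    ContinuousLinearMap.inCoordinates E (TangentSpace I : M → Type _) (E →L[ℝ] ℝ)
      (fun x : M => TangentSpace I x →L[ℝ] ℝ) x₀ x x₀ x B u w
      = B (frame x₀ x u) (frame x₀ x w) := by
  have hb := mem_baseSet_of_mem_source (I := I) hx
  have h := inCoordinates_apply_eq₂ (F₃ := ℝ) (E₃ := fun _ : M => ℝ) (ϕ := B) (v := u) (w := w)
    hb hb (by simp : x ∈ (trivializationAt ℝ (Bundle.Trivial M ℝ) x₀).baseSet)
  refine h.trans ?_
  rw [← Trivialization.symmL_apply (R := ℝ) _ hb, ← Trivialization.symmL_apply (R := ℝ) _ hb]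
  simp [frame]

omit [FiniteDimensional ℝ E] in
theorem contDiffAt_metricRep [I.Boundaryless] (g : TangentMetric I M) (x₀ : M) :
    ContDiffAt ℝ ∞ (metricRep g x₀) (extChartAt I x₀ x₀) := by
  have h := contDiffAt_comp_extChartAt_symm ((contMDiffAt_hom_bundle _).1 (g.contMDiff x₀)).2
  refine h.congr_of_eventuallyEq ?_
  filter_upwards [eventually_mem_source_chart (I := I) x₀] with z hz
  refine ContinuousLinearMap.ext fun u => ContinuousLinearMap.ext fun w => ?_
  exact (inCoordinates_bilinear (symm_mem_source hz) _ u w).symm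

theorem isInvertible_metricRep (g : TangentMetric I M) {x₀ x : M}
    (hx : x ∈ (chartAt H x₀).source) : (metricRep g x₀ (extChartAt I x₀ x)).IsInvertible := by
  have hinj : Function.Injective (metricRep g x₀ (extChartAt I x₀ x)).toLinearMap := by
    rw [injective_iff_map_eq_zero]
    intro u hu
    by_contra hne
    have hf : frame (I := I) x₀ x u ≠ 0 := fun h0 => hne (by
      rw [← coframe_frame (I := I) hx u, h0, map_zero])
    have h0 : metricRep g x₀ (extChartAt I x₀ x) u u = 0 :=
      congrArg (fun φ : E →L[ℝ] ℝ => φ u) hu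
    rw [metricRep_extChartAt g hx] at h0
    exact (g.pos x _ hf).ne' h0
  have hrank : Module.finrank ℝ E = Module.finrank ℝ (E →L[ℝ] ℝ) :=
    ((LinearMap.toContinuousLinearMap (𝕜 := ℝ) (E := E) (F' := ℝ)).finrank_eq.symm.trans
      (Subspace.dual_finrank_eq (K := ℝ) (V := E))).symm
  have hbij := (LinearMap.injective_iff_surjective_of_finrank_eq_finrank hrank).1 hinj
  exact ⟨(LinearEquiv.ofBijective _ ⟨hinj, hbij⟩).toContinuousLinearEquiv,
    ContinuousLinearMap.ext fun _ => rfl⟩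

theorem inverse_metricRep (g : TangentMetric I M) {x₀ x : M}
    (hx : x ∈ (chartAt H x₀).source) (β : Cotangent I x) :
    (metricRep g x₀ (extChartAt I x₀ x)).inverse (β.comp (frame x₀ x))
      = coframe x₀ x (sharp g x β) := by
  have h : metricRep g x₀ (extChartAt I x₀ x) (coframe x₀ x (sharp g x β))
      = β.comp (frame x₀ x) := by
    refine ContinuousLinearMap.ext fun w => ?_
    rw [metricRep_extChartAt g hx, frame_coframe hx, inner_sharp]
    rfl
  obtain ⟨e, he⟩ := isInvertible_metricRep g hx
  rw [← h, ← he, ContinuousLinearMap.inverse_equiv]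
  exact e.symm_apply_apply _

/-- `♯_g` as a continuous linear map. -/
def sharpCLM (g : TangentMetric I M) (x : M) : Cotangent I x →L[ℝ] TangentSpace I x :=
  haveI : FiniteDimensional ℝ (Cotangent I x) :=
    inferInstanceAs (FiniteDimensional ℝ (E →L[ℝ] ℝ))
  haveI : T2Space (Cotangent I x) := inferInstanceAs (T2Space (E →L[ℝ] ℝ))
  (sharp g x).toContinuousLinearMap

/-- The lifted metric, as a continuous bilinear form. -/
def liftedInner (cov : TangentConnection I M) (g : TangentMetric I M) (a : CotangentBundle I M) :
    TangentSpace (cotangentModel I) a →L[ℝ] TangentSpace (cotangentModel I) a →L[ℝ] ℝ :=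
  let S := (PhiEquiv cov a).symm.toContinuousLinearMap
  let S₁ := (ContinuousLinearMap.fst ℝ (TangentSpace I a.proj) (Cotangent I a.proj)).comp S
  let S₂ := (ContinuousLinearMap.snd ℝ (TangentSpace I a.proj) (Cotangent I a.proj)).comp S
  (ContinuousLinearMap.precomp ℝ S₁).comp ((g.inner a.proj).comp S₁)
    + (ContinuousLinearMap.precomp ℝ ((sharpCLM g a.proj).comp S₂)).comp S₂

theorem liftedInner_apply (cov : TangentConnection I M) (g : TangentMetric I M)
    (a : CotangentBundle I M) (A B : TangentSpace (cotangentModel I) a) :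
    liftedInner cov g a A B = liftedMetric cov g a A B := by
  change g.inner a.proj ((PhiEquiv cov a).symm A).1 ((PhiEquiv cov a).symm B).1
    + ((PhiEquiv cov a).symm A).2 (sharp g a.proj ((PhiEquiv cov a).symm B).2) = _
  rw [← inner_sharp g a.proj ((PhiEquiv cov a).symm A).2]
  rfl

theorem liftedMetric_PhiEquiv (cov : TangentConnection I M) (g : TangentMetric I M)
    (a : CotangentBundle I M) (s t : TangentSpace I a.proj × Cotangent I a.proj) :
    liftedMetric cov g a (PhiEquiv cov a s) (PhiEquiv cov a t)
      = generalizedMetric g a.proj s t := by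
  rw [liftedMetric, ContinuousLinearEquiv.symm_apply_apply, ContinuousLinearEquiv.symm_apply_apply]

theorem generalizedMetric_comm (g : TangentMetric I M) (x : M)
    (s t : TangentSpace I x × Cotangent I x) :
    generalizedMetric g x s t = generalizedMetric g x t s := by
  rw [generalizedMetric, generalizedMetric, g.symm x s.1, g.symm x (sharp g x s.2)]

omit [FiniteDimensional ℝ E] in
theorem inner_self_nonneg (g : TangentMetric I M) (x : M) (v : TangentSpace I x) :
    0 ≤ g.inner x v v := by
  by_cases h : v = 0
  · rw [h, map_zero]
  · exact (g.pos x v h).le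

theorem generalizedMetric_pos (g : TangentMetric I M) (x : M)
    {s : TangentSpace I x × Cotangent I x} (hs : s ≠ 0) : 0 < generalizedMetric g x s s := by
  by_cases h : s.1 = 0
  · have h2 : s.2 ≠ 0 := fun h2 => hs (Prod.ext h h2)
    have h3 : sharp g x s.2 ≠ 0 := fun h3 => h2 (by
      refine ContinuousLinearMap.ext fun w => ?_
      rw [← inner_sharp g, h3, map_zero])
    exact add_pos_of_nonneg_of_pos (inner_self_nonneg g x _) (g.pos x _ h3)
  · exact add_pos_of_pos_of_nonneg (g.pos x _ h) (inner_self_nonneg g x _)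

theorem isVonNBounded_liftedInner (cov : TangentConnection I M) (g : TangentMetric I M)
    (a : CotangentBundle I M) :
    Bornology.IsVonNBounded ℝ {A : TangentSpace (cotangentModel I) a | liftedInner cov g a A A < 1} := by
  have hg := g.isVonNBounded a.proj
  let T₁ : TangentSpace I a.proj →L[ℝ] TangentSpace (cotangentModel I) a :=
    (PhiEquiv cov a).toContinuousLinearMap.comp
      (ContinuousLinearMap.inl ℝ (TangentSpace I a.proj) (Cotangent I a.proj))
  let T₂ : TangentSpace I a.proj →L[ℝ] TangentSpace (cotangentModel I) a :=
    ((PhiEquiv cov a).toContinuousLinearMap.comp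
      (ContinuousLinearMap.inr ℝ (TangentSpace I a.proj) (Cotangent I a.proj))).comp
        (g.inner a.proj)
  refine ((hg.image T₁).add (hg.image T₂)).subset fun A hA => ?_
  obtain ⟨s, rfl⟩ := (PhiEquiv cov a).surjective A
  rw [Set.mem_ofPred_eq, liftedInner_apply, liftedMetric_PhiEquiv, generalizedMetric] at hA
  have h1 := inner_self_nonneg g a.proj s.1
  have h2 := inner_self_nonneg g a.proj (sharp g a.proj s.2)
  refine Set.mem_add.2 ⟨T₁ s.1, ⟨s.1, ?_, rfl⟩, T₂ (sharp g a.proj s.2),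
    ⟨sharp g a.proj s.2, ?_, rfl⟩, ?_⟩
  · exact lt_of_le_of_lt (le_add_of_nonneg_right h2) hA
  · exact lt_of_le_of_lt (le_add_of_nonneg_left h1) hA
  · have h3 : g.inner a.proj (sharp g a.proj s.2) = s.2 :=
      ContinuousLinearMap.ext fun w => inner_sharp g _ _ w
    change PhiEquiv cov a (s.1, 0) + PhiEquiv cov a (0, g.inner a.proj (sharp g a.proj s.2)) = _
    rw [h3, ← ContinuousLinearEquiv.map_add, Prod.mk_add_mk, add_zero, zero_add]

/-- The vertical part of a tangent vector of the cotangent bundle, in coordinates. -/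
def verticalRep (Γ : E → E →L[ℝ] E →L[ℝ] E) (z : E × (E →L[ℝ] ℝ)) :
    (E × (E →L[ℝ] ℝ)) →L[ℝ] (E →L[ℝ] ℝ) :=
  ContinuousLinearMap.snd ℝ E (E →L[ℝ] ℝ) -
    ((ContinuousLinearMap.compL ℝ E E ℝ z.2).comp (Γ z.1).flip).comp
      (ContinuousLinearMap.fst ℝ E (E →L[ℝ] ℝ))

set_option synthInstance.maxHeartbeats 200000 in
omit [FiniteDimensional ℝ E] in
theorem contDiffAt_verticalRep {Γ : E → E →L[ℝ] E →L[ℝ] E} {z : E × (E →L[ℝ] ℝ)}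
    (hΓ : ContDiffAt ℝ ∞ Γ z.1) : ContDiffAt ℝ ∞ (verticalRep Γ) z := by
  have h1 : ContDiffAt ℝ ∞ (fun z : E × (E →L[ℝ] ℝ) => Γ z.1) z := hΓ.comp z contDiffAt_fst
  have h2 : ContDiffAt ℝ ∞ (fun z : E × (E →L[ℝ] ℝ) => (Γ z.1).flip) z :=
    (ContinuousLinearMap.flipₗᵢ ℝ E E E).contDiff.contDiffAt.comp z h1
  have c : ContDiff ℝ ∞ (fun ξ : E →L[ℝ] ℝ => ContinuousLinearMap.compL ℝ E E ℝ ξ) :=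
    ContinuousLinearMap.contDiff _
  have h3 := c.contDiffAt.comp z (contDiffAt_snd (p := z))
  exact contDiffAt_const.sub ((h3.clm_comp h2).clm_comp contDiffAt_const)

omit [FiniteDimensional ℝ E] in
theorem contMDiffAt_bilinear_of_frame {B : ∀ x : M, TangentSpace I x →L[ℝ] TangentSpace I x →L[ℝ] ℝ}
    {R : E → E →L[ℝ] E →L[ℝ] ℝ} {x₀ : M} (hR : ContDiffAt ℝ ∞ R (extChartAt I x₀ x₀))
    (hB : ∀ᶠ x in nhds x₀, ∀ u w : E,
      B x (frame x₀ x u) (frame x₀ x w) = R (extChartAt I x₀ x) u w) :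
    ContMDiffAt I (I.prod 𝓘(ℝ, E →L[ℝ] E →L[ℝ] ℝ)) ∞
      (fun x => TotalSpace.mk' (E →L[ℝ] E →L[ℝ] ℝ) x (B x)) x₀ := by
  rw [contMDiffAt_hom_bundle]
  refine ⟨contMDiffAt_id, (contMDiffAt_comp_extChartAt hR).congr_of_eventuallyEq ?_⟩
  filter_upwards [hB, (chartAt H x₀).open_source.mem_nhds (mem_chart_source H x₀)] with x hx hs
  refine ContinuousLinearMap.ext fun u => ContinuousLinearMap.ext fun w => ?_
  exact (inCoordinates_bilinear hs _ u w).trans (hx u w)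

/-- The bilinear form `(A, B) ↦ g(ρ A, ρ B) + θ(A)(γ(θ B))`. -/
def sumForm {F : Type*} [NormedAddCommGroup F] [NormedSpace ℝ F] (ρ : F →L[ℝ] E)
    (g : E →L[ℝ] E →L[ℝ] ℝ) (γ : (E →L[ℝ] ℝ) →L[ℝ] E) (θ : F →L[ℝ] (E →L[ℝ] ℝ)) :
    F →L[ℝ] F →L[ℝ] ℝ :=
  ((ContinuousLinearMap.compL ℝ F E ℝ).flip ρ).comp (g.comp ρ)
    + ((ContinuousLinearMap.compL ℝ F E ℝ).flip (γ.comp θ)).comp θ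

omit [FiniteDimensional ℝ E] in
theorem contDiffAt_inverse_comp {F D : Type*} [NormedAddCommGroup F] [NormedSpace ℝ F]
    [NormedAddCommGroup D] [NormedSpace ℝ D] [CompleteSpace E] {g : F → E →L[ℝ] D} {z : F}
    (hg : ContDiffAt ℝ ∞ g z) (hinv : (g z).IsInvertible) :
    ContDiffAt ℝ ∞ (fun z => (g z).inverse) z := by
  have h : ContDiffAt ℝ ∞ (ContinuousLinearMap.inverse : (E →L[ℝ] D) → _) (g z) :=
    hinv.contDiffAt_map_inverse
  exact h.comp z hg

theorem contDiffAt_sumForm {F : Type*} [NormedAddCommGroup F] [NormedSpace ℝ F] {ρ : F →L[ℝ] E}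
    {g : E → E →L[ℝ] E →L[ℝ] ℝ} {θ : F → F →L[ℝ] (E →L[ℝ] ℝ)} {z : F}
    (hg : ContDiffAt ℝ ∞ g (ρ z)) (hinv : (g (ρ z)).IsInvertible) (hθ : ContDiffAt ℝ ∞ θ z) :
    ContDiffAt ℝ ∞ (fun z => sumForm ρ (g (ρ z)) (g (ρ z)).inverse (θ z)) z := by
  have := FiniteDimensional.complete ℝ E
  have h1 : ContDiffAt ℝ ∞ (fun z => g (ρ z)) z := hg.comp z ρ.contDiff.contDiffAt
  have h2 := contDiffAt_inverse_comp h1 hinv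
  have c : ContDiff ℝ ∞ (fun T : F →L[ℝ] E => (ContinuousLinearMap.compL ℝ F E ℝ).flip T) :=
    ContinuousLinearMap.contDiff _
  have h3 := c.contDiffAt.comp z (h2.clm_comp hθ)
  exact (contDiffAt_const.clm_comp (h1.clm_comp contDiffAt_const)).add (h3.clm_comp hθ)

variable [T2Space M]

theorem verticalRep_coframe_PhiEquiv (cov : TangentConnection I M) {a₀ b : CotangentBundle I M}
    (hb : b.proj ∈ (chartAt H a₀.proj).source)
    (hfr : ∀ᶠ x in nhds b.proj, ∀ w : E, globalFrame (I := I) a₀.proj w x = frame a₀.proj x w)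
    (s : TangentSpace I b.proj × Cotangent I b.proj) :
    verticalRep (christoffel cov a₀.proj) (extChartAt (cotangentModel I) a₀ b)
      (coframe a₀ b (PhiEquiv cov b s)) = s.2.comp (frame a₀.proj b.proj) := by
  rw [coframe_PhiEquiv cov hb hfr, extChartAt_cotangent a₀ b]
  exact add_sub_cancel_right _ _

theorem liftedInner_frame (cov : TangentConnection I M) (g : TangentMetric I M)
    {a₀ b : CotangentBundle I M} (hb : b.proj ∈ (chartAt H a₀.proj).source)
    (hfr : ∀ᶠ x in nhds b.proj, ∀ w : E, globalFrame (I := I) a₀.proj w x = frame a₀.proj x w)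
    (A B : E × (E →L[ℝ] ℝ)) :
    liftedInner cov g b (frame a₀ b A) (frame a₀ b B)
      = metricRep g a₀.proj (extChartAt (cotangentModel I) a₀ b).1 A.1 B.1
        + verticalRep (christoffel cov a₀.proj) (extChartAt (cotangentModel I) a₀ b) A
          ((metricRep g a₀.proj (extChartAt (cotangentModel I) a₀ b).1).inverse
            (verticalRep (christoffel cov a₀.proj) (extChartAt (cotangentModel I) a₀ b) B)) := by
  have hb' := mem_chart_source_cotangent hb
  rw [liftedInner_apply]
  obtain ⟨s, hs'⟩ := (PhiEquiv cov b).surjective (frame a₀ b A)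
  obtain ⟨t, ht'⟩ := (PhiEquiv cov b).surjective (frame a₀ b B)
  have hA : coframe a₀ b (PhiEquiv cov b s) = A := by rw [hs', coframe_frame hb']
  have hB : coframe a₀ b (PhiEquiv cov b t) = B := by rw [ht', coframe_frame hb']
  rw [← hs', ← ht', liftedMetric_PhiEquiv, ← hA, ← hB]
  have hfst (r : TangentSpace I b.proj × Cotangent I b.proj) :
      (coframe a₀ b (PhiEquiv cov b r)).1 = coframe a₀.proj b.proj r.1 := by
    rw [coframe_PhiEquiv cov hb hfr]
  have hz : (extChartAt (cotangentModel I) a₀ b).1 = extChartAt I a₀.proj b.proj := by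
    rw [extChartAt_cotangent a₀ b]
  rw [verticalRep_coframe_PhiEquiv cov hb hfr, verticalRep_coframe_PhiEquiv cov hb hfr, hfst, hfst,
    hz, metricRep_extChartAt g hb, frame_coframe hb, frame_coframe hb, inverse_metricRep g hb,
    ContinuousLinearMap.comp_apply, frame_coframe hb, generalizedMetric, inner_sharp]

/-- The lifted metric on the cotangent bundle, as a smooth Riemannian metric. -/
def liftedTangentMetric [I.Boundaryless] {cov : TangentConnection I M}
    (hcov : CovariantDerivative.ContMDiffCovariantDerivative cov ∞) (g : TangentMetric I M) :
    TangentMetric (cotangentModel I) (CotangentBundle I M) where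
  inner := liftedInner cov g
  symm a A B := by
    rw [liftedInner_apply, liftedInner_apply]
    exact generalizedMetric_comm g a.proj _ _
  pos a A hA := by
    rw [liftedInner_apply]
    exact generalizedMetric_pos g a.proj fun h =>
      hA ((PhiEquiv cov a).symm.injective (h.trans (map_zero (PhiEquiv cov a).symm).symm))
  isVonNBounded := isVonNBounded_liftedInner cov g
  contMDiff a₀ := by
    have hs := mem_chart_source H a₀.proj
    have h0 : ContinuousLinearMap.fst ℝ E (E →L[ℝ] ℝ) (extChartAt (cotangentModel I) a₀ a₀)
        = extChartAt I a₀.proj a₀.proj := by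
      rw [ContinuousLinearMap.coe_fst', extChartAt_cotangent a₀ a₀]
    have hΓ : ContDiffAt ℝ ∞ (christoffel cov a₀.proj) (ContinuousLinearMap.fst ℝ E (E →L[ℝ] ℝ)
        (extChartAt (cotangentModel I) a₀ a₀)) := h0.symm ▸ contDiffAt_christoffel hcov a₀.proj
    refine contMDiffAt_bilinear_of_frame (contDiffAt_sumForm
      (ρ := ContinuousLinearMap.fst ℝ E (E →L[ℝ] ℝ)) (g := metricRep g a₀.proj)
      (θ := verticalRep (christoffel cov a₀.proj)) (h0.symm ▸ contDiffAt_metricRep g a₀.proj)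
      (h0.symm ▸ isInvertible_metricRep g hs)
      (contDiffAt_verticalRep hΓ)) ?_
    filter_upwards [eventually_proj ((chartAt H a₀.proj).open_source.mem_nhds hs),
      eventually_proj (globalFrame_eventuallyEq (I := I) a₀.proj).eventually_nhds] with b hb hfr A B
    exact liftedInner_frame cov g hb hfr A B

end Metric

section Structure

variable {E : Type*} [NormedAddCommGroup E] [NormedSpace ℝ E] [FiniteDimensional ℝ E]
  {H : Type*} [TopologicalSpace H] {I : ModelWithCorners ℝ E H}
  {M : Type*} [TopologicalSpace M] [ChartedSpace H M] [IsManifold I ∞ M]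

theorem liftedJ_PhiEquiv (cov : TangentConnection I M)
    (J : ∀ x : M, TangentSpace I x →L[ℝ] TangentSpace I x) (a : CotangentBundle I M)
    (s : TangentSpace I a.proj × Cotangent I a.proj) :
    liftedJ cov J a (PhiEquiv cov a s) = PhiEquiv cov a (generalizedJ J a.proj s) := by
  change PhiEquiv cov a (generalizedJ J a.proj ((PhiEquiv cov a).symm (PhiEquiv cov a s))) = _
  rw [ContinuousLinearEquiv.symm_apply_apply]

omit [FiniteDimensional ℝ E] in
theorem generalizedJ_sq {p q : ℝ} {J : ∀ x : M, TangentSpace I x →L[ℝ] TangentSpace I x}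
    (hJ : IsMetallicStructure p q J) (x : M) (s : TangentSpace I x × Cotangent I x) :
    generalizedJ J x (generalizedJ J x s) = p • generalizedJ J x s + q • s := by
  refine Prod.ext (hJ.sq_eq x s.1) (ContinuousLinearMap.ext fun w => ?_)
  change s.2 (J x (J x w)) = p • s.2 (J x w) + q • s.2 w
  rw [hJ.sq_eq, map_add, map_smul, map_smul]

theorem sharp_comp {p q : ℝ} {J : ∀ x : M, TangentSpace I x →L[ℝ] TangentSpace I x}
    {g : TangentMetric I M} (h : IsMetallicRiemannianStructure p q J g) (x : M)
    (β : Cotangent I x) : sharp g x (β.comp (J x)) = J x (sharp g x β) := by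
  refine (flat_bijective g x).1 (ContinuousLinearMap.ext fun w => ?_)
  rw [inner_sharp, h.compatible, inner_sharp]
  rfl

theorem generalizedMetric_generalizedJ {p q : ℝ}
    {J : ∀ x : M, TangentSpace I x →L[ℝ] TangentSpace I x}
    {g : TangentMetric I M} (h : IsMetallicRiemannianStructure p q J g) (x : M)
    (s t : TangentSpace I x × Cotangent I x) :
    generalizedMetric g x (generalizedJ J x s) t = generalizedMetric g x s (generalizedJ J x t) := by
  change g.inner x (J x s.1) t.1 + g.inner x (sharp g x (s.2.comp (J x))) (sharp g x t.2)
    = g.inner x s.1 (J x t.1) + g.inner x (sharp g x s.2) (sharp g x (t.2.comp (J x)))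
  rw [sharp_comp h, sharp_comp h, h.compatible, h.compatible]

end Structure
end Metallic
end

theorem mainTheorem12
    {E : Type*} [NormedAddCommGroup E] [NormedSpace ℝ E] [FiniteDimensional ℝ E]
    {H : Type*} [TopologicalSpace H] (I : ModelWithCorners ℝ E H) [I.Boundaryless]
    {M : Type*} [TopologicalSpace M] [ChartedSpace H M] [T2Space M] [IsManifold I ∞ M]
    (p q : ℝ)
    (J : ∀ x : M, TangentSpace I x →L[ℝ] TangentSpace I x)
    (g : Metallic.TangentMetric I M)
    (hJg : Metallic.IsMetallicRiemannianStructure p q J g)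
    (cov : Metallic.TangentConnection I M)
    (hcov : Metallic.IsLeviCivita g cov)
    (hparallel : Metallic.IsParallel cov J)
    (hflat : Metallic.IsFlat cov) :
    ∃ G : Metallic.TangentMetric (Metallic.cotangentModel I) (Metallic.CotangentBundle I M),
      (∀ (a : Metallic.CotangentBundle I M)
        (A B : TangentSpace (Metallic.cotangentModel I) a),
        G.inner a A B = Metallic.liftedMetric cov g a A B) ∧
      Metallic.IsMetallicRiemannianStructure p q (Metallic.liftedJ cov J) G ∧
      Metallic.IsIntegrable (Metallic.liftedJ cov J) := by
  have hJ := hJg.metallic.smooth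
  have hsmooth (a : Metallic.CotangentBundle I M) : ContDiffAt ℝ ∞
      (Metallic.endoRep (Metallic.liftedJ cov J) a)
      (extChartAt (Metallic.cotangentModel I) a a) := by
    refine ContDiffAt.congr_of_eventuallyEq (Metallic.contDiffAt_cotangentLift ?_)
      (Metallic.endoRep_liftedJ hJ hparallel hcov.torsion_free a)
    rw [Metallic.extChartAt_cotangent a a]
    exact Metallic.contMDiffAt_endo_iff.1 (hJ a.proj)
  refine ⟨Metallic.liftedTangentMetric hcov.smooth g, Metallic.liftedInner_apply cov g,
    ⟨⟨fun a => Metallic.contMDiffAt_endo_iff.2 (hsmooth a), fun a A => ?_⟩, fun a A B => ?_⟩,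
    fun X Y hX hY a => ?_⟩
  · obtain ⟨s, rfl⟩ := (Metallic.PhiEquiv cov a).surjective A
    rw [Metallic.liftedJ_PhiEquiv, Metallic.liftedJ_PhiEquiv,
      Metallic.generalizedJ_sq hJg.metallic, map_add, map_smul, map_smul]
  · obtain ⟨s, rfl⟩ := (Metallic.PhiEquiv cov a).surjective A
    obtain ⟨t, rfl⟩ := (Metallic.PhiEquiv cov a).surjective B
    change Metallic.liftedInner cov g a _ _ = Metallic.liftedInner cov g a _ _
    rw [Metallic.liftedInner_apply, Metallic.liftedInner_apply, Metallic.liftedJ_PhiEquiv,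
      Metallic.liftedJ_PhiEquiv, Metallic.liftedMetric_PhiEquiv, Metallic.liftedMetric_PhiEquiv,
      Metallic.generalizedMetric_generalizedJ hJg]
  · have hrep := Metallic.endoRep_liftedJ hJ hparallel hcov.torsion_free a
    have hfst : (extChartAt (Metallic.cotangentModel I) a a).1 = extChartAt I a.proj a.proj := by
      rw [Metallic.extChartAt_cotangent a a]
    have hzero (A B : E × (E →L[ℝ] ℝ)) : Metallic.nijenhuisAt
        (Metallic.endoRep (Metallic.liftedJ cov J) a)
        (extChartAt (Metallic.cotangentModel I) a a) A B = 0 := by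
      rw [Metallic.nijenhuisAt, hrep.fderiv_eq, hrep.self_of_nhds]
      refine Metallic.nijenhuisAt_cotangentLift ?_ ?_ A B
      · rw [hfst]
        exact Metallic.contMDiffAt_endo_iff.1 (hJ a.proj)
      · rw [hfst]
        exact Metallic.nijenhuisAt_endoRep_of_isParallel hJ hparallel hcov.torsion_free a.proj
    rw [Metallic.nijenhuis_eq_frame hX hY ((hsmooth a).differentiableAt (by simp)), hzero]
    exact ContinuousLinearMap.map_zero _
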